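/- Let $d$ be a natural number and let $\underline{C}=(C_1,\dots,C_d)$ be a row contraction on a complex Hilbert space $\mathcal H_C$, i.e. the row operator $\bigoplus_{j=1}^d\mathcal H_C\to\mathcal H_C$, $(\xi_j)\mapsto\sum_j C_j\xi_j$, is a contraction. *Notation.* For a row contraction $\underline T$ on $\mathcal H_T$ let $D_T=(\delta_{ij}I-T_i^*T_j)^{1/2}$ on $\bigoplus_{j=1}^d\mathcal H_T$ be its defect operator and $\mathcal D_T=\overline{\operatorname{range} D_T}$ its defect space. Let $\Gamma=\bigoplus_{n\ge 0}(\mathbb C^d)^{\otimes n}$ be the full Fock space with vacuum vector $e_\emptyset$ and left creation operators $L_1,\dots,L_d$. The minimal isometric dilation $\underline V^T$ of $\underline T$ acts on $\mathcal H_T\oplus(\Gamma\otimes\mathcal D_T)$ by $V^T_j(x\oplus\eta)=T_jx\oplus\big(e_\emptyset\otimes D_T(0,\dots,x,\dots,0)+(L_j\otimes I)\eta\big)$, with $x$ in the $j$-th place. For a word $\alpha=\alpha_1\cdots\alpha_m$ in the letters $1,\dots,d$ put $T_\alpha=T_{\alpha_1}\cdots T_{\alpha_m}$ ($T_\emptyset=I$).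 For Hilbert spaces $\mathcal D,\mathcal L$, a bounded operator $M:\Gamma\otimes\mathcal D\to\Gamma\otimes\mathcal L$ is *multi-analytic* if $M(L_j\otimes I)=(L_j\otimes I)M$ for all $j$, and *contractive* if $\|M\|\le 1$; its *symbol* is $\Theta:\mathcal D\to\Gamma\otimes\mathcal L$, $\Theta(\delta)=M(e_\emptyset\otimes\delta)$. A *contractive lifting* of $\underline C$ is a row contraction $\underline E=(E_1,\dots,E_d)$ on a Hilbert space $\mathcal H_E=\mathcal H_C\oplus\mathcal H_A$ of the block form $E_j=\begin{pmatrix}C_j&0\\B_j&A_j\end{pmatrix}$. It is *minimal* if $\overline{\operatorname{span}}\{E_\alpha x: x\in\mathcal H_C,\ \alpha \text{ a word}\}=\mathcal H_E$. Its *characteristic function* is the contractive multi-analytic operator $M_{C,E}:\Gamma\otimes\mathcal D_E\to\Gamma\otimes\mathcal D_C$, $M_{C,E}=U^*|_{\Gamma\otimes\mathcal D_E}$, where $U:\Gamma\otimes\mathcal D_C\to\mathcal H_E\oplus(\Gamma\otimes\mathcal D_E)$ is the isometry determined by $U(e_\alpha\otimes D_C(\xi_i)_i)=V^E_\alpha\sum_i(V^E_i-C_i)\xi_i$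 for all words $\alpha$ and all $(\xi_i)_i\in\bigoplus_{i=1}^d\mathcal H_C$; that is, $M_{C,E}$ is the orthogonal projection onto $\bigoplus_\alpha V^E_\alpha\mathcal L_C\cong\Gamma\otimes\mathcal D_C$ restricted to $\Gamma\otimes\mathcal D_E$, where $\mathcal L_C=\overline{\operatorname{span}}\{\mathcal H_C,V^E_1\mathcal H_C,\dots,V^E_d\mathcal H_C\}\ominus\mathcal H_C$. Given a contractive multi-analytic $M:\Gamma\otimes\mathcal D\to\Gamma\otimes\mathcal D_C$, put $\Delta=(I-M^*M)^{1/2}$ and $\hat{\mathcal H}=\mathcal H_C\oplus(\Gamma\otimes\mathcal D_C)\oplus\overline{\Delta(\Gamma\otimes\mathcal D)}$. Let $\hat{\underline V}$ be the row isometry on $\hat{\mathcal H}$ that restricts to $\underline V^C$ on $\mathcal H_C\oplus(\Gamma\otimes\mathcal D_C)$ and to $\Delta\xi\mapsto\Delta(L_j\otimes I)\xi$ on $\overline{\Delta(\Gamma\otimes\mathcal D)}$, and let $W:\Gamma\otimes\mathcal D\to\hat{\mathcal H}$ be the isometry $W\xi=0\oplus M\xi\oplus\Delta\xi$. The contractive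 lifting $\mathcal E(M)=\underline E$ of $\underline C$ acts on $\mathcal H_E=\hat{\mathcal H}\ominus W(\Gamma\otimes\mathcal D)\supset\mathcal H_C$ by $E_j=P_{\mathcal H_E}\hat V_j|_{\mathcal H_E}$. **Statement.** 1. If $\underline E$ is a minimal contractive lifting of $\underline C$, then the symbol of its characteristic function $M_{C,E}$ is injective. 2. Conversely, let $\mathcal D$ be a Hilbert space and $M:\Gamma\otimes\mathcal D\to\Gamma\otimes\mathcal D_C$ a contractive multi-analytic operator with injective symbol. Then the contractive lifting $\underline E=\mathcal E(M)$ is minimal and $M$ is its characteristic function, up to the canonical identification of $\mathcal D$ with $\mathcal D_E$: there is a unitary $v:\mathcal D\to\mathcal D_E$ such that $J(v\delta)=W(e_\emptyset\otimes\delta)$ for all $\delta\in\mathcal D$, where $J:\mathcal D_E\to\hat{\mathcal H}$ is the isometry determined by $J(D_E(\xi_i)_i)=\sum_i(\hat V_i-E_i)\xi_i$, and $M_{C,E}\,(I\otimes v)=M$. -/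

import Mathlib

set_option linter.unusedSectionVars false

open scoped InnerProductSpace

noncomputable section

namespace RowLifting

open ContinuousLinearMap

/-! ### Operators on Hilbert spaces: defects, closures of ranges, direct sums -/

section Generalities

variable {X Y Z : Type*}
  [NormedAddCommGroup X] [InnerProductSpace ℂ X] [CompleteSpace X]
  [NormedAddCommGroup Y] [InnerProductSpace ℂ Y] [CompleteSpace Y]
  [NormedAddCommGroup Z] [InnerProductSpace ℂ Z] [CompleteSpace Z]

/-- The defect operator `(I - A* A)^(1/2)` of a contraction `A`. -/
def defectOp (A : X →L[ℂ] Y) : X →L[ℂ] X :=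
  CFC.sqrt (1 - adjoint A ∘L A)

theorem inner_defectOp (A : X →L[ℂ] Y) (hA : ‖A‖ ≤ 1) (x y : X) :
    ⟪defectOp A x, defectOp A y⟫_ℂ = ⟪x, y⟫_ℂ - ⟪A x, A y⟫_ℂ := by
  have hsa : IsSelfAdjoint (1 - adjoint A ∘L A) := by
    refine IsSelfAdjoint.sub (IsSelfAdjoint.one _) ?_
    rw [isSelfAdjoint_iff, star_eq_adjoint, adjoint_comp, adjoint_adjoint]
  have hpos : (0 : X →L[ℂ] X) ≤ 1 - adjoint A ∘L A := by
    rw [nonneg_iff_isPositive, isPositive_def]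
    refine ⟨hsa.isSymmetric, fun y => ?_⟩
    have h1 : ‖A y‖ ≤ ‖y‖ := by
      simpa using A.le_of_opNorm_le hA y
    have h2 : 0 ≤ ‖y‖ ^ 2 - ‖A y‖ ^ 2 := by
      nlinarith [norm_nonneg (A y), norm_nonneg y]
    simpa only [reApplyInnerSelf_apply, sub_apply, one_apply_eq_self, comp_apply, inner_sub_left,
      adjoint_inner_left, map_sub, inner_self_eq_norm_sq] using h2
  have hs : IsSelfAdjoint (defectOp A) := (CFC.sqrt_nonneg _).isSelfAdjoint
  have hsq : defectOp A * defectOp A = 1 - adjoint A ∘L A := CFC.sqrt_mul_sqrt_self _ hpos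
  have h3 : ⟪defectOp A x, defectOp A y⟫_ℂ = ⟪x, (defectOp A * defectOp A) y⟫_ℂ :=
    hs.isSymmetric x (defectOp A y)
  rw [h3, hsq, sub_apply, inner_sub_right, one_apply_eq_self, comp_apply, adjoint_inner_right]

theorem norm_defectOp_sq (A : X →L[ℂ] Y) (hA : ‖A‖ ≤ 1) (x : X) :
    ‖defectOp A x‖ ^ 2 = ‖x‖ ^ 2 - ‖A x‖ ^ 2 := by
  have h := congrArg RCLike.re (inner_defectOp A hA x x)
  simpa only [map_sub, inner_self_eq_norm_sq] using h

/-- The closure of the range of an operator, as a Hilbert space. -/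
def RangeClosure (A : X →L[ℂ] Y) : Type _ :=
  (LinearMap.range A.toLinearMap).topologicalClosure

instance (A : X →L[ℂ] Y) : NormedAddCommGroup (RangeClosure A) :=
  inferInstanceAs (NormedAddCommGroup (LinearMap.range A.toLinearMap).topologicalClosure)

instance (A : X →L[ℂ] Y) : InnerProductSpace ℂ (RangeClosure A) :=
  inferInstanceAs (InnerProductSpace ℂ (LinearMap.range A.toLinearMap).topologicalClosure)

instance (A : X →L[ℂ] Y) : CompleteSpace (RangeClosure A) :=
  inferInstanceAs (CompleteSpace (LinearMap.range A.toLinearMap).topologicalClosure)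

/-- The inclusion of the closure of the range. -/
def RangeClosure.incl (A : X →L[ℂ] Y) : RangeClosure A →ₗᵢ[ℂ] Y :=
  (LinearMap.range A.toLinearMap).topologicalClosure.subtypeₗᵢ

/-- An operator, seen as an operator into the closure of its range. -/
def toRangeClosure (A : X →L[ℂ] Y) : X →L[ℂ] RangeClosure A :=
  A.codRestrict (LinearMap.range A.toLinearMap).topologicalClosure fun x =>
    Submodule.le_topologicalClosure _ (LinearMap.mem_range_self _ x)

@[simp] theorem incl_toRangeClosure (A : X →L[ℂ] Y) (x : X) :
    RangeClosure.incl A (toRangeClosure A x) = A x := rfl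

@[simp] theorem norm_toRangeClosure (A : X →L[ℂ] Y) (x : X) :
    ‖toRangeClosure A x‖ = ‖A x‖ := rfl

theorem inner_toRangeClosure (A : X →L[ℂ] Y) (x y : X) :
    ⟪toRangeClosure A x, toRangeClosure A y⟫_ℂ = ⟪A x, A y⟫_ℂ := rfl

theorem denseRange_toRangeClosure (A : X →L[ℂ] Y) : DenseRange (toRangeClosure A) := by
  intro y
  have hi : Topology.IsInducing (RangeClosure.incl A) :=
    (RangeClosure.incl A).isometry.isEmbedding.isInducing
  have hy : RangeClosure.incl A y ∈ closure (Set.range A) := by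
    have h : RangeClosure.incl A y ∈ (LinearMap.range A.toLinearMap).topologicalClosure :=
      Subtype.property (p := fun z => z ∈ (LinearMap.range A.toLinearMap).topologicalClosure) y
    rw [← SetLike.mem_coe, Submodule.topologicalClosure_coe] at h
    exact h
  rw [hi.closure_eq_preimage_closure_image, Set.mem_preimage, ← Set.range_comp]
  exact hy

/-- If `‖B x‖ = ‖A x‖` for all `x`, the isometry with `A x ↦ B x` on the closure of the range of
`A`. -/
def rangeIsometry (A : X →L[ℂ] Y) (B : X →L[ℂ] Z) (h : ∀ x, ‖B x‖ = ‖A x‖) :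
    RangeClosure A →ₗᵢ[ℂ] Z where
  toLinearMap := (B.toLinearMap.extendOfNorm (toRangeClosure A).toLinearMap).toLinearMap
  norm_map' y := by
    have hx : ∀ x, B.toLinearMap.extendOfNorm (toRangeClosure A).toLinearMap
        (toRangeClosure A x) = B x := fun x =>
      LinearMap.extendOfNorm_eq (denseRange_toRangeClosure A) ⟨1, fun x => by simp [h]⟩ x
    refine (denseRange_toRangeClosure A).induction_on
      (p := fun y => ‖B.toLinearMap.extendOfNorm (toRangeClosure A).toLinearMap y‖ = ‖y‖) y ?_ ?_
    · exact isClosed_eq (by fun_prop) (by fun_prop)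
    · intro x
      rw [hx, h, norm_toRangeClosure]

@[simp] theorem rangeIsometry_apply (A : X →L[ℂ] Y) (B : X →L[ℂ] Z) (h : ∀ x, ‖B x‖ = ‖A x‖)
    (x : X) : rangeIsometry A B h (toRangeClosure A x) = B x :=
  LinearMap.extendOfNorm_eq (denseRange_toRangeClosure A) ⟨1, fun x => by simp [h]⟩ x

/-- The operator `x ↦ A x ⊕ B x` into an orthogonal direct sum. -/
def colOp (A : X →L[ℂ] Y) (B : X →L[ℂ] Z) : X →L[ℂ] WithLp 2 (Y × Z) :=
  ((WithLp.prodContinuousLinearEquiv 2 ℂ Y Z).symm : (Y × Z) →L[ℂ] WithLp 2 (Y × Z)) ∘L A.prod B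

@[simp] theorem colOp_apply (A : X →L[ℂ] Y) (B : X →L[ℂ] Z) (x : X) :
    colOp A B x = WithLp.toLp 2 (A x, B x) := rfl

/-- The embedding of the first summand. -/
def inlᵢ (Y Z : Type*) [NormedAddCommGroup Y] [InnerProductSpace ℂ Y]
    [NormedAddCommGroup Z] [InnerProductSpace ℂ Z] : Y →ₗᵢ[ℂ] WithLp 2 (Y × Z) where
  toFun y := WithLp.toLp 2 (y, 0)
  map_add' a b := by rw [← WithLp.toLp_add, Prod.mk_add_mk, add_zero]
  map_smul' c a := by rw [RingHom.id_apply, ← WithLp.toLp_smul, Prod.smul_mk, smul_zero]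
  norm_map' y := WithLp.norm_toLp_fst 2 _ _ y

/-- The embedding of the second summand. -/
def inrᵢ (Y Z : Type*) [NormedAddCommGroup Y] [InnerProductSpace ℂ Y]
    [NormedAddCommGroup Z] [InnerProductSpace ℂ Z] : Z →ₗᵢ[ℂ] WithLp 2 (Y × Z) where
  toFun z := WithLp.toLp 2 (0, z)
  map_add' a b := by rw [← WithLp.toLp_add, Prod.mk_add_mk, add_zero]
  map_smul' c a := by rw [RingHom.id_apply, ← WithLp.toLp_smul, Prod.smul_mk, smul_zero]
  norm_map' z := WithLp.norm_toLp_snd 2 _ _ z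

@[simp] theorem inlᵢ_apply (y : Y) : inlᵢ Y Z y = WithLp.toLp 2 (y, 0) := rfl
@[simp] theorem inrᵢ_apply (z : Z) : inrᵢ Y Z z = WithLp.toLp 2 (0, z) := rfl

theorem inner_toLp (a c : Y) (b e : Z) :
    ⟪(WithLp.toLp 2 (a, b) : WithLp 2 (Y × Z)), WithLp.toLp 2 (c, e)⟫_ℂ = ⟪a, c⟫_ℂ + ⟪b, e⟫_ℂ := rfl

theorem inner_withLp (x y : WithLp 2 (Y × Z)) :
    ⟪x, y⟫_ℂ = ⟪x.fst, y.fst⟫_ℂ + ⟪x.snd, y.snd⟫_ℂ := rfl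

theorem inner_inrᵢ (x : WithLp 2 (Y × Z)) (z : Z) : ⟪x, inrᵢ Y Z z⟫_ℂ = ⟪x.snd, z⟫_ℂ := by
  rw [inner_withLp]
  simp

theorem inrᵢ_inner (x : WithLp 2 (Y × Z)) (z : Z) : ⟪inrᵢ Y Z z, x⟫_ℂ = ⟪z, x.snd⟫_ℂ := by
  rw [inner_withLp]
  simp

theorem inlᵢ_inner (x : WithLp 2 (Y × Z)) (y : Y) : ⟪inlᵢ Y Z y, x⟫_ℂ = ⟪y, x.fst⟫_ℂ := by
  rw [inner_withLp]
  simp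

theorem norm_adjoint_isometry_le (J : X →ₗᵢ[ℂ] Y) (y : Y) :
    ‖adjoint J.toContinuousLinearMap y‖ ≤ ‖y‖ := by
  have h := J.norm_toContinuousLinearMap_le
  rw [← LinearIsometryEquiv.norm_map adjoint] at h
  simpa using le_of_opNorm_le _ h y

theorem inner_adjoint_inrᵢ (U : X →ₗᵢ[ℂ] WithLp 2 (Y × Z)) (x : X) (z : Z) :
    ⟪x, adjoint U.toContinuousLinearMap (inrᵢ Y Z z)⟫_ℂ = ⟪(U x).snd, z⟫_ℂ := by
  rw [adjoint_inner_right, ← inner_inrᵢ]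
  rfl

theorem adjoint_inlᵢ_apply (x : WithLp 2 (Y × Z)) :
    adjoint (inlᵢ Y Z).toContinuousLinearMap x = x.fst := by
  refine ext_inner_left ℂ fun h => ?_
  rw [adjoint_inner_right]
  exact inlᵢ_inner x h

end Generalities

/-! ### Tuples of operators -/

section Tuples

variable {d : ℕ} {H K L : Type*}
  [NormedAddCommGroup H] [InnerProductSpace ℂ H] [CompleteSpace H]
  [NormedAddCommGroup K] [InnerProductSpace ℂ K] [CompleteSpace K]
  [NormedAddCommGroup L] [InnerProductSpace ℂ L] [CompleteSpace L]

/-- The row operator `ξ₁ ⊕ ⋯ ⊕ ξ_d ↦ ∑ T_j ξ_j` of a tuple. -/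
def rowOp (T : Fin d → H →L[ℂ] K) : PiLp 2 (fun _ : Fin d => H) →L[ℂ] K :=
  ∑ j, T j ∘L PiLp.proj 2 (fun _ : Fin d => H) j

theorem rowOp_apply (T : Fin d → H →L[ℂ] K) (ξ : PiLp 2 (fun _ : Fin d => H)) :
    rowOp T ξ = ∑ j, T j (ξ j) := by
  simp [rowOp]

/-- The embedding of `H` as the `j`-th summand of `H ⊕ ⋯ ⊕ H`. -/
def summandEmb (d : ℕ) (H : Type*) [NormedAddCommGroup H] [InnerProductSpace ℂ H] (j : Fin d) :
    H →ₗᵢ[ℂ] PiLp 2 (fun _ : Fin d => H) where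
  toFun x := PiLp.single 2 j x
  map_add' _ _ := PiLp.single_add 2 j
  map_smul' c x := by
    ext i
    by_cases h : i = j
    · subst h; simp
    · simp [h]
  norm_map' x := PiLp.norm_single 2 (fun _ : Fin d => H) j x

theorem summandEmb_apply (j : Fin d) (x : H) (i : Fin d) :
    summandEmb d H j x i = if i = j then x else 0 := by
  change (PiLp.single (β := fun _ : Fin d => H) 2 j x) i = _
  split_ifs with h
  · subst h; simp
  · simp [h]

/-- The operator `T_α = T_{α₁} ⋯ T_{α_m}` for a word `α = α₁ ⋯ α_m`. -/
def wordOp (T : Fin d → H →L[ℂ] H) (α : List (Fin d)) : H →L[ℂ] H :=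
  (α.map T).prod

@[simp] theorem wordOp_nil (T : Fin d → H →L[ℂ] H) (x : H) : wordOp T [] x = x := by
  simp [wordOp]

@[simp] theorem wordOp_cons (T : Fin d → H →L[ℂ] H) (j : Fin d) (α : List (Fin d)) (x : H) :
    wordOp T (j :: α) x = T j (wordOp T α x) := by
  simp [wordOp]

/-- A row contraction: a `d`-tuple whose row operator is a contraction. -/
structure RowContraction (d : ℕ) (H : Type*) [NormedAddCommGroup H] [InnerProductSpace ℂ H] where
  /-- the entries of the tuple -/
  op : Fin d → H →L[ℂ] H
  norm_rowOp_le : ‖rowOp op‖ ≤ 1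

/-- The defect operator `D_T = (δ_{ij} I - T_i* T_j)^{1/2}` on `H ⊕ ⋯ ⊕ H`. -/
abbrev RowContraction.defect (T : RowContraction d H) :
    PiLp 2 (fun _ : Fin d => H) →L[ℂ] PiLp 2 (fun _ : Fin d => H) :=
  defectOp (rowOp T.op)

/-- The defect space: the closure of the range of `D_T`. -/
abbrev RowContraction.DefectSpace (T : RowContraction d H) : Type _ :=
  RangeClosure T.defect

/-- Row isometries: the `V_j` are isometries with mutually orthogonal ranges. -/
def IsRowIsometry (V : Fin d → K →L[ℂ] K) : Prop :=
  ∀ i j x y, ⟪V i x, V j y⟫_ℂ = if i = j then ⟪x, y⟫_ℂ else 0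

theorem IsRowIsometry.norm_rowOp {V : Fin d → K →L[ℂ] K} (hV : IsRowIsometry V)
    (ξ : PiLp 2 (fun _ : Fin d => K)) : ‖rowOp V ξ‖ = ‖ξ‖ := by
  have h : ⟪rowOp V ξ, rowOp V ξ⟫_ℂ = ⟪ξ, ξ⟫_ℂ := by
    rw [rowOp_apply, sum_inner, PiLp.inner_apply]
    refine Finset.sum_congr rfl fun i _ => ?_
    rw [inner_sum]
    simp_rw [hV i]
    simp
  rw [inner_self_eq_norm_sq_to_K, inner_self_eq_norm_sq_to_K] at h
  have h' : ‖rowOp V ξ‖ ^ 2 = ‖ξ‖ ^ 2 := by exact_mod_cast h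
  exact (sq_eq_sq₀ (norm_nonneg _) (norm_nonneg _)).1 h'

/-- `E` on `K` is a lifting of `C` on `H`, where `H` is regarded as a subspace of `K` by means of
the isometry `J`: with respect to `K = J H ⊕ (J H)ᗮ` every `E_j` is a block matrix with first row
`(C_j, 0)`. -/
structure IsLifting (C : Fin d → H →L[ℂ] H) (E : Fin d → K →L[ℂ] K) (J : H →ₗᵢ[ℂ] K) : Prop where
  corner : ∀ j h, adjoint J.toContinuousLinearMap (E j (J h)) = C j h
  upper_right : ∀ j, ∀ y ∈ (LinearMap.range J.toLinearMap)ᗮ,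
    E j y ∈ (LinearMap.range J.toLinearMap)ᗮ

theorem adjoint_isometry_apply (J : H →ₗᵢ[ℂ] K) (h : H) :
    adjoint J.toContinuousLinearMap (J h) = h := by
  refine ext_inner_left ℂ fun x => ?_
  rw [adjoint_inner_right]
  exact J.inner_map_map x h

theorem mem_orthogonal_range_iff (J : H →ₗᵢ[ℂ] K) (y : K) :
    y ∈ (LinearMap.range J.toLinearMap)ᗮ ↔ adjoint J.toContinuousLinearMap y = 0 := by
  constructor
  · intro hy
    refine ext_inner_left ℂ fun x => ?_
    rw [adjoint_inner_right, inner_zero_right]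
    exact (Submodule.mem_orthogonal _ _).1 hy _ (LinearMap.mem_range_self _ x)
  · intro hy
    rw [Submodule.mem_orthogonal]
    rintro _ ⟨x, rfl⟩
    have := adjoint_inner_right J.toContinuousLinearMap x y
    rw [hy, inner_zero_right] at this
    exact this.symm

theorem isLifting_iff (C : Fin d → H →L[ℂ] H) (E : Fin d → K →L[ℂ] K) (J : H →ₗᵢ[ℂ] K) :
    IsLifting C E J ↔ ∀ j y, adjoint J.toContinuousLinearMap (E j y) =
      C j (adjoint J.toContinuousLinearMap y) := by
  constructor
  · intro h j y
    set y' := adjoint J.toContinuousLinearMap y with hy'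
    have h0 : y - J y' ∈ (LinearMap.range J.toLinearMap)ᗮ := by
      rw [mem_orthogonal_range_iff, map_sub, adjoint_isometry_apply, ← hy', sub_self]
    have h1 := h.upper_right j _ h0
    rw [mem_orthogonal_range_iff, map_sub, map_sub, h.corner, sub_eq_zero] at h1
    exact h1
  · intro h
    refine ⟨fun j x => by rw [h, adjoint_isometry_apply], fun j y hy => ?_⟩
    rw [mem_orthogonal_range_iff] at hy ⊢
    rw [h, hy, map_zero]

theorem IsLifting.trans {C : Fin d → H →L[ℂ] H} {E : Fin d → K →L[ℂ] K} {F : Fin d → L →L[ℂ] L}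
    {J : H →ₗᵢ[ℂ] K} {J' : K →ₗᵢ[ℂ] L} (h : IsLifting C E J) (h' : IsLifting E F J') :
    IsLifting C F (J'.comp J) := by
  rw [isLifting_iff] at h h' ⊢
  intro j y
  have e : adjoint (J'.comp J).toContinuousLinearMap =
      adjoint J.toContinuousLinearMap ∘L adjoint J'.toContinuousLinearMap := by
    rw [← adjoint_comp]; rfl
  rw [e, comp_apply, comp_apply, h', h]

theorem IsLifting.inner_left {C : Fin d → H →L[ℂ] H} {E : Fin d → K →L[ℂ] K} {J : H →ₗᵢ[ℂ] K}
    (h : IsLifting C E J) (j : Fin d) (x : H) (y : K) :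
    ⟪J x, E j y⟫_ℂ = ⟪J (adjoint (C j) x), y⟫_ℂ := by
  have h1 := (isLifting_iff C E J).1 h j y
  have h2 := adjoint_inner_right J.toContinuousLinearMap x (E j y)
  have h3 := adjoint_inner_right J.toContinuousLinearMap (adjoint (C j) x) y
  rw [h1] at h2
  rw [adjoint_inner_left] at h3
  exact h2.symm.trans h3

end Tuples

/-! ### Fock spaces and multi-analytic operators -/

section FockSpace

variable {d : ℕ} {D L K : Type*}
  [NormedAddCommGroup D] [InnerProductSpace ℂ D] [CompleteSpace D]
  [NormedAddCommGroup L] [InnerProductSpace ℂ L] [CompleteSpace L]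
  [NormedAddCommGroup K] [InnerProductSpace ℂ K] [CompleteSpace K]

/-- The Hilbert space `Γ ⊗ D`, where `Γ` is the full Fock space over `ℂ^d`. The vectors
`e_α = e_{α₁} ⊗ ⋯ ⊗ e_{α_m}`, for all words `α` in the letters `1, …, d`, are an orthonormal basis
of `Γ`; an element `∑ e_α ⊗ δ_α` of `Γ ⊗ D` is the square-summable family `(δ_α)`. -/
abbrev Fock (d : ℕ) (D : Type*) [NormedAddCommGroup D] : Type _ :=
  lp (fun _ : List (Fin d) => D) 2

theorem norm_single_fock (α : List (Fin d)) (x : D) : ‖(lp.single 2 α x : Fock d D)‖ = ‖x‖ :=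
  lp.norm_single (p := 2) (E := fun _ : List (Fin d) => D) (by norm_num) α x

/-- The isometry `δ ↦ e_α ⊗ δ`. -/
def basisVec (α : List (Fin d)) : D →ₗᵢ[ℂ] Fock d D where
  toFun x := lp.single 2 α x
  map_add' x y := lp.single_add (E := fun _ : List (Fin d) => D) 2 α x y
  map_smul' c x := lp.single_smul (E := fun _ : List (Fin d) => D) 2 α c x
  norm_map' x := norm_single_fock α x

theorem basisVec_apply (α β : List (Fin d)) (x : D) :
    (basisVec α x : Fock d D) β = if β = α then x else 0 := by
  change (lp.single 2 α x : Fock d D) β = _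
  rw [lp.single_apply, Pi.single_apply]

theorem inner_basisVec_left (α : List (Fin d)) (x : D) (f : Fock d D) :
    ⟪basisVec α x, f⟫_ℂ = ⟪x, f α⟫_ℂ :=
  lp.inner_single_left α x f

theorem inner_basisVec (α β : List (Fin d)) (x y : D) :
    ⟪(basisVec α x : Fock d D), basisVec β y⟫_ℂ = if α = β then ⟪x, y⟫_ℂ else 0 := by
  rw [inner_basisVec_left, basisVec_apply]
  split_ifs <;> simp

theorem orthogonalFamily_shift (j : Fin d) :
    OrthogonalFamily ℂ (fun _ : List (Fin d) => D)
      fun α => (basisVec (j :: α) : D →ₗᵢ[ℂ] Fock d D) := by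
  intro α β hαβ x y
  rw [inner_basisVec, if_neg]
  simpa using hαβ

/-- The creation operator `L_j ⊗ I`, that is the isometry with `e_α ⊗ δ ↦ e_{jα} ⊗ δ`. -/
def creation (j : Fin d) : Fock d D →ₗᵢ[ℂ] Fock d D :=
  (orthogonalFamily_shift j).linearIsometry

@[simp] theorem creation_basisVec (j : Fin d) (α : List (Fin d)) (x : D) :
    creation j (basisVec α x : Fock d D) = basisVec (j :: α) x :=
  (orthogonalFamily_shift j).linearIsometry_apply_single x

/-- Two operators on `Γ ⊗ D` agree if they agree on all `e_α ⊗ δ`. -/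
theorem fock_ext {A B : Fock d D →L[ℂ] K}
    (h : ∀ α x, A (basisVec α x) = B (basisVec α x)) : A = B := by
  ext f
  have hf := lp.hasSum_single (p := 2) (by norm_num) f
  have hA := hf.mapL A
  have hB := hf.mapL B
  refine hA.unique ?_
  convert! hB using 2 with α
  exact h α (f α)

theorem creation_nil (j : Fin d) (f : Fock d D) : creation j f [] = 0 := by
  refine ext_inner_left ℂ fun x => ?_
  rw [← inner_basisVec_left, inner_zero_right]
  have h : (innerSL ℂ (basisVec [] x : Fock d D)) ∘L (creation j).toContinuousLinearMap = 0 := by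
    refine fock_ext fun α y => ?_
    simp [inner_basisVec]
  simpa using congrArg (fun A => A f) h

theorem creation_cons (i j : Fin d) (α : List (Fin d)) (f : Fock d D) :
    creation j f (i :: α) = if i = j then f α else 0 := by
  refine ext_inner_left ℂ fun x => ?_
  rw [← inner_basisVec_left]
  split_ifs with hij
  · subst hij
    rw [← creation_basisVec]
    exact ((creation (D := D) i).inner_map_map (basisVec α x) f).trans (inner_basisVec_left α x f)
  · rw [inner_zero_right]
    have h : (innerSL ℂ (basisVec (i :: α) x : Fock d D)) ∘L
        (creation j).toContinuousLinearMap = 0 := by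
      refine fock_ext fun β y => ?_
      simp [inner_basisVec, hij]
    simpa using congrArg (fun A => A f) h

theorem inner_creation (i j : Fin d) (f g : Fock d D) :
    ⟪creation i f, creation j g⟫_ℂ = if i = j then ⟪f, g⟫_ℂ else 0 := by
  split_ifs with hij
  · subst hij
    exact (creation i).inner_map_map f g
  · rw [lp.inner_eq_tsum]
    convert tsum_zero with α
    cases α with
    | nil => rw [creation_nil, inner_zero_left]
    | cons k α =>
      rw [creation_cons, creation_cons]
      by_cases hk : k = i
      · rw [if_neg (show ¬ k = j from fun h => hij (hk.symm.trans h)), inner_zero_right]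
      · rw [if_neg hk, inner_zero_left]

theorem orthogonalFamily_amplify (v : D →ₗᵢ[ℂ] L) :
    OrthogonalFamily ℂ (fun _ : List (Fin d) => D)
      fun α => ((basisVec α).comp v : D →ₗᵢ[ℂ] Fock d L) := by
  intro α β hαβ x y
  exact (inner_basisVec α β (v x) (v y)).trans (if_neg hαβ)

/-- The isometry `I ⊗ v`, that is `e_α ⊗ δ ↦ e_α ⊗ v δ`. -/
def amplify (d : ℕ) (v : D →ₗᵢ[ℂ] L) : Fock d D →ₗᵢ[ℂ] Fock d L :=
  (orthogonalFamily_amplify v).linearIsometry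

@[simp] theorem amplify_basisVec (v : D →ₗᵢ[ℂ] L) (α : List (Fin d)) (x : D) :
    amplify d v (basisVec α x) = basisVec α (v x) :=
  (orthogonalFamily_amplify v).linearIsometry_apply_single x

variable (d D L) in
/-- Contractive multi-analytic operators `Γ ⊗ D → Γ ⊗ L`. -/
structure ContractiveMultiAnalytic where
  /-- the operator -/
  toCLM : Fock d D →L[ℂ] Fock d L
  norm_le : ‖toCLM‖ ≤ 1
  intertwine : ∀ j f, toCLM (creation j f) = creation j (toCLM f)

/-- The symbol `δ ↦ M (e_∅ ⊗ δ)`. -/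
def ContractiveMultiAnalytic.symbol (M : ContractiveMultiAnalytic d D L) : D →L[ℂ] Fock d L :=
  M.toCLM ∘L (basisVec []).toContinuousLinearMap

end FockSpace

/-! ### The canonical isometry `Γ ⊗ D_T → K` of an isometric dilation -/

section Dilation

variable {d : ℕ} {H K : Type*}
  [NormedAddCommGroup H] [InnerProductSpace ℂ H] [CompleteSpace H]
  [NormedAddCommGroup K] [InnerProductSpace ℂ K] [CompleteSpace K]

/-- A row isometry `V` on `K ⊇ H` which is a lifting, and hence a dilation, of `T`. -/
structure IsIsometricLifting (T : RowContraction d H) (V : Fin d → K →L[ℂ] K)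
    (J : H →ₗᵢ[ℂ] K) : Prop where
  isometry : IsRowIsometry V
  lifting : IsLifting T.op V J

/-- The operator `⊕ ξ_i ↦ ∑ (V_i - T_i) ξ_i`. -/
def rowDiff (T : RowContraction d H) (V : Fin d → K →L[ℂ] K) (J : H →ₗᵢ[ℂ] K) :
    PiLp 2 (fun _ : Fin d => H) →L[ℂ] K :=
  rowOp fun i => V i ∘L J.toContinuousLinearMap - J.toContinuousLinearMap ∘L T.op i

theorem rowDiff_apply (T : RowContraction d H) (V : Fin d → K →L[ℂ] K) (J : H →ₗᵢ[ℂ] K)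
    (ξ : PiLp 2 (fun _ : Fin d => H)) :
    rowDiff T V J ξ = ∑ i, (V i (J (ξ i)) - J (T.op i (ξ i))) := by
  simp [rowDiff, rowOp_apply]

variable {T : RowContraction d H} {V : Fin d → K →L[ℂ] K} {J : H →ₗᵢ[ℂ] K}

theorem IsIsometricLifting.norm_rowDiff (h : IsIsometricLifting T V J)
    (ξ : PiLp 2 (fun _ : Fin d => H)) : ‖rowDiff T V J ξ‖ = ‖T.defect ξ‖ := by
  rw [← sq_eq_sq₀ (norm_nonneg _) (norm_nonneg _), norm_defectOp_sq _ T.norm_rowOp_le]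
  set η : PiLp 2 (fun _ : Fin d => K) := WithLp.toLp 2 fun i => J (ξ i) with hη
  have e1 : rowDiff T V J ξ = rowOp V η - J (rowOp T.op ξ) := by
    simp [rowDiff_apply, rowOp_apply, Finset.sum_sub_distrib, hη]
  have e2 : ‖rowOp V η‖ = ‖ξ‖ := by
    rw [h.isometry.norm_rowOp, PiLp.norm_eq_of_L2, PiLp.norm_eq_of_L2]
    simp [hη]
  have e3 : ⟪J (rowOp T.op ξ), rowOp V η⟫_ℂ = ⟪rowOp T.op ξ, rowOp T.op ξ⟫_ℂ := by
    rw [rowOp_apply V, inner_sum]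
    nth_rewrite 3 [rowOp_apply T.op]
    rw [inner_sum]
    refine Finset.sum_congr rfl fun i _ => ?_
    rw [h.lifting.inner_left]
    simp [hη, J.inner_map_map, adjoint_inner_left]
  rw [e1, @norm_sub_sq ℂ, e2, J.norm_map, ← inner_conj_symm, e3, RCLike.conj_re,
    inner_self_eq_norm_sq]
  ring

/-- The canonical isometry `D_T → K`, `D_T (⊕ ξ_i) ↦ ∑ (V_i - T_i) ξ_i`, of an isometric
dilation; its range is the wandering subspace `span {H, V (H ⊕ ⋯ ⊕ H)}⁻ ⊖ H`. -/
def IsIsometricLifting.defectEmb (h : IsIsometricLifting T V J) : T.DefectSpace →ₗᵢ[ℂ] K :=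
  rangeIsometry T.defect (rowDiff T V J) h.norm_rowDiff

theorem IsIsometricLifting.inner_word (h : IsIsometricLifting T V J) (α : List (Fin d)) :
    ∀ (x : H) (δ : T.DefectSpace), ⟪J x, wordOp V α (h.defectEmb δ)⟫_ℂ = 0 := by
  induction α with
  | nil =>
    intro x δ
    rw [wordOp_nil]
    refine (denseRange_toRangeClosure T.defect).induction_on
      (p := fun δ => ⟪J x, h.defectEmb δ⟫_ℂ = 0) δ ?_ ?_
    · exact isClosed_eq (continuous_const.inner h.defectEmb.continuous) continuous_const
    · intro ξ
      rw [IsIsometricLifting.defectEmb, rangeIsometry_apply, rowDiff_apply, inner_sum]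
      refine Finset.sum_eq_zero fun i _ => ?_
      rw [inner_sub_right, h.lifting.inner_left, J.inner_map_map, J.inner_map_map,
        adjoint_inner_left, sub_self]
  | cons j α ih =>
    intro x δ
    rw [wordOp_cons, h.lifting.inner_left, ih]

theorem IsIsometricLifting.inner_wandering (h : IsIsometricLifting T V J) (j : Fin d)
    (α : List (Fin d)) (δ ε : T.DefectSpace) :
    ⟪h.defectEmb δ, V j (wordOp V α (h.defectEmb ε))⟫_ℂ = 0 := by
  refine (denseRange_toRangeClosure T.defect).induction_on
      (p := fun δ => ⟪h.defectEmb δ, V j (wordOp V α (h.defectEmb ε))⟫_ℂ = 0) δ ?_ ?_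
  · exact isClosed_eq (h.defectEmb.continuous.inner continuous_const) continuous_const
  · intro ξ
    nth_rewrite 1 [IsIsometricLifting.defectEmb]
    rw [rangeIsometry_apply, rowDiff_apply, sum_inner]
    refine Finset.sum_eq_zero fun i _ => ?_
    rw [inner_sub_left, ← wordOp_cons, h.inner_word, wordOp_cons, h.isometry, h.inner_word]
    simp

theorem IsRowIsometry.inner_map (hV : IsRowIsometry V) (j : Fin d) (x y : K) :
    ⟪V j x, V j y⟫_ℂ = ⟪x, y⟫_ℂ := by
  rw [hV, if_pos rfl]

theorem IsRowIsometry.inner_wordOp (hV : IsRowIsometry V) (α : List (Fin d)) (x y : K) :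
    ⟪wordOp V α x, wordOp V α y⟫_ℂ = ⟪x, y⟫_ℂ := by
  induction α with
  | nil => simp
  | cons j α ih => rw [wordOp_cons, wordOp_cons, hV.inner_map, ih]

/-- The isometry `δ ↦ V_α δ`, where `δ` is first mapped into `K` canonically. -/
def IsIsometricLifting.wordEmb (h : IsIsometricLifting T V J) (α : List (Fin d)) :
    T.DefectSpace →ₗᵢ[ℂ] K :=
  LinearMap.isometryOfInner ((wordOp V α).toLinearMap ∘ₗ h.defectEmb.toLinearMap) fun x y => by
    simpa using! (h.isometry.inner_wordOp α (h.defectEmb x) (h.defectEmb y)).trans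
      (h.defectEmb.inner_map_map x y)

theorem IsIsometricLifting.wordEmb_apply (h : IsIsometricLifting T V J) (α : List (Fin d))
    (δ : T.DefectSpace) : h.wordEmb α δ = wordOp V α (h.defectEmb δ) := rfl

theorem IsIsometricLifting.orthogonalFamily (h : IsIsometricLifting T V J) :
    OrthogonalFamily ℂ (fun _ : List (Fin d) => T.DefectSpace) h.wordEmb := by
  intro α
  induction α with
  | nil =>
    intro β hβ x y
    cases β with
    | nil => exact absurd rfl hβ
    | cons j β =>
      rw [h.wordEmb_apply, h.wordEmb_apply, wordOp_nil, wordOp_cons, h.inner_wandering]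
  | cons i α ih =>
    intro β hβ x y
    cases β with
    | nil =>
      rw [h.wordEmb_apply, h.wordEmb_apply, wordOp_nil, wordOp_cons, ← inner_conj_symm,
        h.inner_wandering, map_zero]
    | cons j β =>
      rw [h.wordEmb_apply, h.wordEmb_apply, wordOp_cons, wordOp_cons, h.isometry]
      split_ifs with hij
      · subst hij
        exact ih (fun e => hβ (by rw [e])) x y
      · rfl

/-- The canonical isometry `Γ ⊗ D_T → K`, `e_α ⊗ D_T (⊕ ξ_i) ↦ V_α ∑ (V_i - T_i) ξ_i`, with range
`⊕_α V_α L_T`, where `L_T = span {H, V (H ⊕ ⋯ ⊕ H)}⁻ ⊖ H`. -/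
def IsIsometricLifting.fockEmb (h : IsIsometricLifting T V J) : Fock d T.DefectSpace →ₗᵢ[ℂ] K :=
  h.orthogonalFamily.linearIsometry

theorem IsIsometricLifting.fockEmb_basisVec (h : IsIsometricLifting T V J) (α : List (Fin d))
    (δ : T.DefectSpace) : h.fockEmb (basisVec α δ) = wordOp V α (h.defectEmb δ) :=
  h.orthogonalFamily.linearIsometry_apply_single δ

theorem IsIsometricLifting.fockEmb_creation (h : IsIsometricLifting T V J) (j : Fin d)
    (f : Fock d T.DefectSpace) : h.fockEmb (creation j f) = V j (h.fockEmb f) := by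
  have e : h.fockEmb.toContinuousLinearMap ∘L (creation j).toContinuousLinearMap =
      V j ∘L h.fockEmb.toContinuousLinearMap := by
    refine fock_ext fun α x => ?_
    simp [h.fockEmb_basisVec]
  exact congrArg (fun A => A f) e

/-! ### The minimal isometric dilation -/

/-- The space `H ⊕ (Γ ⊗ D_T)` of the minimal isometric dilation. -/
abbrev RowContraction.DilationSpace (T : RowContraction d H) : Type _ :=
  WithLp 2 (H × Fock d T.DefectSpace)

/-- The `j`-th column `x ↦ e_∅ ⊗ D_T (0 ⊕ ⋯ ⊕ x ⊕ ⋯ ⊕ 0)` of the defect operator. -/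
def RowContraction.defectColumn (T : RowContraction d H) (j : Fin d) :
    H →L[ℂ] Fock d T.DefectSpace :=
  (basisVec []).toContinuousLinearMap ∘L toRangeClosure T.defect ∘L
    (summandEmb d H j).toContinuousLinearMap

/-- The minimal isometric dilation on `H ⊕ (Γ ⊗ D_T)`, in its canonical form:
`V_j (x ⊕ η) = T_j x ⊕ (e_∅ ⊗ D_T (0 ⊕ ⋯ ⊕ x ⊕ ⋯ ⊕ 0) + (L_j ⊗ I) η)`. -/
def RowContraction.dilation (T : RowContraction d H) (j : Fin d) :
    T.DilationSpace →L[ℂ] T.DilationSpace :=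
  colOp (T.op j ∘L WithLp.fstL 2 ℂ H (Fock d T.DefectSpace))
    (T.defectColumn j ∘L WithLp.fstL 2 ℂ H (Fock d T.DefectSpace) +
      (creation j).toContinuousLinearMap ∘L WithLp.sndL 2 ℂ H (Fock d T.DefectSpace))

theorem RowContraction.dilation_apply (T : RowContraction d H) (j : Fin d)
    (x : T.DilationSpace) :
    T.dilation j x = WithLp.toLp 2 (T.op j x.fst, T.defectColumn j x.fst + creation j x.snd) := rfl

theorem RowContraction.inner_defectColumn (T : RowContraction d H) (i j : Fin d) (x y : H) :
    ⟪T.op i x, T.op j y⟫_ℂ + ⟪T.defectColumn i x, T.defectColumn j y⟫_ℂ =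
      if i = j then ⟪x, y⟫_ℂ else 0 := by
  have h1 : ⟪T.defectColumn i x, T.defectColumn j y⟫_ℂ =
      ⟪T.defect (summandEmb d H i x), T.defect (summandEmb d H j y)⟫_ℂ :=
    (basisVec (d := d) (D := T.DefectSpace) []).inner_map_map _ _
  have h2 : ∀ k z, rowOp T.op (summandEmb d H k z) = T.op k z := by
    intro k z
    rw [rowOp_apply, Finset.sum_eq_single k]
    · rw [summandEmb_apply, if_pos rfl]
    · intro l _ hl
      rw [summandEmb_apply, if_neg hl, map_zero]
    · simp
  have h3 : ⟪summandEmb d H i x, summandEmb d H j y⟫_ℂ = if i = j then ⟪x, y⟫_ℂ else 0 := by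
    rw [PiLp.inner_apply, Finset.sum_eq_single i]
    · rw [summandEmb_apply, summandEmb_apply, if_pos rfl]
      split_ifs <;> simp
    · intro l _ hl
      rw [summandEmb_apply, if_neg hl, inner_zero_left]
    · simp
  rw [h1, inner_defectOp _ T.norm_rowOp_le, h2, h2, h3, add_sub_cancel]

theorem RowContraction.inner_defectColumn_creation (T : RowContraction d H) (i j : Fin d) (x : H)
    (f : Fock d T.DefectSpace) : ⟪T.defectColumn i x, creation j f⟫_ℂ = 0 := by
  change ⟪basisVec [] _, creation j f⟫_ℂ = 0
  rw [inner_basisVec_left, creation_nil, inner_zero_right]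

theorem RowContraction.isRowIsometry_dilation (T : RowContraction d H) :
    IsRowIsometry T.dilation := by
  intro i j x y
  have h1 := T.inner_defectColumn i j x.fst y.fst
  have h2 := T.inner_defectColumn_creation i j x.fst y.snd
  have h3 := T.inner_defectColumn_creation j i y.fst x.snd
  rw [← inner_conj_symm, map_eq_zero] at h3
  have h4 := inner_creation i j x.snd y.snd
  simp only [T.dilation_apply, WithLp.prod_inner_apply, inner_add_left, inner_add_right, h2, h3,
    h4, add_zero, zero_add, WithLp.ofLp_fst, WithLp.ofLp_snd]
  rw [← add_assoc, h1]
  split_ifs <;> simp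

theorem RowContraction.isIsometricLifting_dilation (T : RowContraction d H) :
    IsIsometricLifting T T.dilation (inlᵢ H (Fock d T.DefectSpace)) where
  isometry := T.isRowIsometry_dilation
  lifting := by
    rw [isLifting_iff]
    intro j y
    rw [adjoint_inlᵢ_apply, adjoint_inlᵢ_apply, T.dilation_apply]
    rfl

end Dilation

/-! ### Compressions of row isometries -/

section Compression

variable {d : ℕ} {X K : Type*}
  [NormedAddCommGroup X] [InnerProductSpace ℂ X] [CompleteSpace X]
  [NormedAddCommGroup K] [InnerProductSpace ℂ K] [CompleteSpace K]

/-- The orthogonal complement of the range of an isometry. -/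
def CompressionSpace (W : X →ₗᵢ[ℂ] K) : Submodule ℂ K := (LinearMap.range W.toLinearMap)ᗮ

instance (W : X →ₗᵢ[ℂ] K) : CompleteSpace (CompressionSpace W) :=
  inferInstanceAs (CompleteSpace (LinearMap.range W.toLinearMap)ᗮ)

instance (W : X →ₗᵢ[ℂ] K) : (CompressionSpace W).HasOrthogonalProjection :=
  inferInstanceAs ((LinearMap.range W.toLinearMap)ᗮ).HasOrthogonalProjection

theorem mem_compressionSpace_iff (W : X →ₗᵢ[ℂ] K) (x : K) :
    x ∈ CompressionSpace W ↔ ∀ ξ, ⟪W ξ, x⟫_ℂ = 0 := by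
  rw [CompressionSpace, Submodule.mem_orthogonal]
  constructor
  · intro hx ξ
    exact hx _ (LinearMap.mem_range_self _ ξ)
  · rintro hx _ ⟨ξ, rfl⟩
    exact hx ξ

/-- The compression of a row isometry `V` to the orthogonal complement of the range of `W`. -/
def compress {V : Fin d → K →L[ℂ] K} (hV : IsRowIsometry V) (W : X →ₗᵢ[ℂ] K) :
    RowContraction d (CompressionSpace W) where
  op j := (CompressionSpace W).orthogonalProjectionOnto ∘L V j ∘L (CompressionSpace W).subtypeL
  norm_rowOp_le := by
    refine opNorm_le_bound _ zero_le_one fun ξ => ?_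
    set η : PiLp 2 (fun _ : Fin d => K) := WithLp.toLp 2 fun i => (ξ i : K) with hη
    have h2 : ‖η‖ = ‖ξ‖ := by
      rw [PiLp.norm_eq_of_L2, PiLp.norm_eq_of_L2]
      simp [hη]
    rw [one_mul, ← h2, ← hV.norm_rowOp η]
    refine le_trans (le_of_eq ?_)
      ((CompressionSpace W).norm_orthogonalProjectionOnto_apply_le (rowOp V η))
    rw [rowOp_apply, rowOp_apply, map_sum]
    rfl

theorem isIsometricLifting_compress {V : Fin d → K →L[ℂ] K} (hV : IsRowIsometry V)
    (W : X →ₗᵢ[ℂ] K) (S : Fin d → X →ₗᵢ[ℂ] X) (hW : ∀ j ξ, V j (W ξ) = W (S j ξ)) :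
    IsIsometricLifting (compress hV W) V (CompressionSpace W).subtypeₗᵢ where
  isometry := hV
  lifting := by
    refine ⟨fun j x => ?_, fun j y hy => ?_⟩
    · exact congrArg (fun A => A (V j x)) (Submodule.adjoint_subtypeL (CompressionSpace W))
    · have hc : IsClosed (LinearMap.range W.toLinearMap : Set K) :=
        W.isometry.isClosedEmbedding.isClosed_range
      have hr : LinearMap.range (CompressionSpace W).subtypeₗᵢ.toLinearMap = CompressionSpace W :=
        Submodule.range_subtype _
      rw [hr, CompressionSpace, Submodule.orthogonal_orthogonal_eq_closure,
        IsClosed.submodule_topologicalClosure_eq hc] at hy ⊢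
      obtain ⟨ξ, rfl⟩ := hy
      exact ⟨S j ξ, (hW j ξ).symm⟩

/-- An isometry with values in the orthogonal complement of the range of `W`. -/
def restrictEmb {H : Type*} [NormedAddCommGroup H] [InnerProductSpace ℂ H]
    (W : X →ₗᵢ[ℂ] K) (J : H →ₗᵢ[ℂ] K) (hJ : ∀ x, J x ∈ CompressionSpace W) :
    H →ₗᵢ[ℂ] CompressionSpace W where
  toLinearMap := J.toLinearMap.codRestrict (CompressionSpace W) hJ
  norm_map' x := J.norm_map x

theorem isLifting_compress {H : Type*} [NormedAddCommGroup H] [InnerProductSpace ℂ H]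
    [CompleteSpace H] {C : Fin d → H →L[ℂ] H} {V : Fin d → K →L[ℂ] K} (hV : IsRowIsometry V)
    (W : X →ₗᵢ[ℂ] K) (J : H →ₗᵢ[ℂ] K) (hJ : ∀ x, J x ∈ CompressionSpace W)
    (h : IsLifting C V J) : IsLifting C (compress hV W).op (restrictEmb W J hJ) := by
  have key : ∀ x : K, adjoint (restrictEmb W J hJ).toContinuousLinearMap
      ((CompressionSpace W).orthogonalProjectionOnto x) = adjoint J.toContinuousLinearMap x := by
    intro x
    refine ext_inner_left ℂ fun y => ?_
    rw [adjoint_inner_right, adjoint_inner_right]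
    exact Submodule.inner_orthogonalProjectionOnto_eq_of_mem_left (restrictEmb W J hJ y) x
  rw [isLifting_iff] at h ⊢
  intro j y
  have h2 := key (y : K)
  rw [Submodule.orthogonalProjectionOnto_mem_subspace_eq_self] at h2
  rw [h2, ← h j (y : K)]
  exact key (V j y)

end Compression

/-! ### Contractive liftings and their characteristic functions -/

section Lifting

variable {d : ℕ} {HC HE : Type*}
  [NormedAddCommGroup HC] [InnerProductSpace ℂ HC] [CompleteSpace HC]
  [NormedAddCommGroup HE] [InnerProductSpace ℂ HE] [CompleteSpace HE]

/-- Contractive liftings of `C` on a Hilbert space `HE ⊇ HC`; the inclusion is the isometry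
`emb`. -/
structure ContractiveLifting (C : RowContraction d HC) (HE : Type*) [NormedAddCommGroup HE]
    [InnerProductSpace ℂ HE] [CompleteSpace HE] where
  /-- the row contraction on `HE` -/
  row : RowContraction d HE
  /-- the inclusion of `HC` in `HE` -/
  emb : HC →ₗᵢ[ℂ] HE
  isLifting : IsLifting C.op row.op emb

variable {C : RowContraction d HC}

/-- `E` is minimal if the vectors `E_α x`, for all words `α` and all `x` in `HC`, span a dense
subspace. -/
def ContractiveLifting.IsMinimal (E : ContractiveLifting C HE) : Prop :=
  (Submodule.span ℂ {y : HE | ∃ (α : List (Fin d)) (x : HC),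
    y = wordOp E.row.op α (E.emb x)}).topologicalClosure = ⊤

/-- The minimal isometric dilation `V^E` of `E` is an isometric dilation of `C` on
`HC ⊆ HE ⊆ HE ⊕ (Γ ⊗ D_E)`. -/
theorem ContractiveLifting.isIsometricLifting (E : ContractiveLifting C HE) :
    IsIsometricLifting C E.row.dilation ((inlᵢ HE (Fock d E.row.DefectSpace)).comp E.emb) where
  isometry := E.row.isRowIsometry_dilation
  lifting := E.isLifting.trans E.row.isIsometricLifting_dilation.lifting

/-- The orthogonal projection from `HE ⊕ (Γ ⊗ D_E)` onto `⊕_α V^E_α L_C`, identified canonically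
with `Γ ⊗ D_C`, restricted to `Γ ⊗ D_E`. -/
def ContractiveLifting.charOp (E : ContractiveLifting C HE) :
    Fock d E.row.DefectSpace →L[ℂ] Fock d C.DefectSpace :=
  adjoint E.isIsometricLifting.fockEmb.toContinuousLinearMap ∘L
    (inrᵢ HE (Fock d E.row.DefectSpace)).toContinuousLinearMap

theorem ContractiveLifting.inner_charOp (E : ContractiveLifting C HE)
    (f : Fock d C.DefectSpace) (g : Fock d E.row.DefectSpace) :
    ⟪f, E.charOp g⟫_ℂ = ⟪(E.isIsometricLifting.fockEmb f).snd, g⟫_ℂ :=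
  inner_adjoint_inrᵢ E.isIsometricLifting.fockEmb f g

theorem ContractiveLifting.norm_charOp_le (E : ContractiveLifting C HE) : ‖E.charOp‖ ≤ 1 := by
  refine opNorm_le_bound _ zero_le_one fun g => ?_
  rw [one_mul]
  refine (norm_adjoint_isometry_le E.isIsometricLifting.fockEmb (inrᵢ HE _ g)).trans ?_
  rw [LinearIsometry.norm_map]

/-- The wandering subspace `L_C` is contained in `HE ⊕ (e_∅ ⊗ D_E)`. -/
theorem ContractiveLifting.inner_defectEmb_creation (E : ContractiveLifting C HE) (j : Fin d)
    (δ : C.DefectSpace) (g : Fock d E.row.DefectSpace) :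
    ⟪(E.isIsometricLifting.defectEmb δ).snd, creation j g⟫_ℂ = 0 := by
  refine (denseRange_toRangeClosure C.defect).induction_on
    (p := fun δ => ⟪(E.isIsometricLifting.defectEmb δ).snd, creation j g⟫_ℂ = 0) δ ?_ ?_
  · refine isClosed_eq (Continuous.inner ?_ continuous_const) continuous_const
    exact (WithLp.sndL 2 ℂ HE (Fock d E.row.DefectSpace)).continuous.comp
      E.isIsometricLifting.defectEmb.continuous
  · intro ξ
    rw [← inner_inrᵢ]
    rw [IsIsometricLifting.defectEmb, rangeIsometry_apply, rowDiff_apply, sum_inner]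
    refine Finset.sum_eq_zero fun i _ => ?_
    have h : (E.row.dilation i (inlᵢ HE (Fock d E.row.DefectSpace) (E.emb (ξ i))) -
        inlᵢ HE (Fock d E.row.DefectSpace) (E.emb (C.op i (ξ i)))).snd =
        E.row.defectColumn i (E.emb (ξ i)) := by
      simp [RowContraction.dilation_apply]
    rw [inner_inrᵢ]
    refine (congrArg (fun z => ⟪z, creation j g⟫_ℂ) h).trans ?_
    exact E.row.inner_defectColumn_creation i j _ _

/-- The characteristic function of a contractive lifting. -/
def ContractiveLifting.charFun (E : ContractiveLifting C HE) :
    ContractiveMultiAnalytic d E.row.DefectSpace C.DefectSpace where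
  toCLM := E.charOp
  norm_le := E.norm_charOp_le
  intertwine j g := by
    have hcr : inrᵢ HE _ (creation j g) = E.row.dilation j (inrᵢ HE _ g) := by
      simp [RowContraction.dilation_apply]
    ext α : 2
    refine ext_inner_left ℂ fun x => ?_
    rw [← inner_basisVec_left, E.inner_charOp, E.isIsometricLifting.fockEmb_basisVec]
    cases α with
    | nil =>
      rw [creation_nil, inner_zero_right, wordOp_nil, E.inner_defectEmb_creation]
    | cons i α =>
      rw [creation_cons, ← inner_inrᵢ, hcr, wordOp_cons, E.row.isRowIsometry_dilation]
      split_ifs with hij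
      · rw [inner_inrᵢ, ← E.isIsometricLifting.fockEmb_basisVec, ← E.inner_charOp,
          inner_basisVec_left]
      · rw [inner_zero_right]

end Lifting

/-! ### The functional model -/

section Model

variable {d : ℕ} {D L : Type*}
  [NormedAddCommGroup D] [InnerProductSpace ℂ D] [CompleteSpace D]
  [NormedAddCommGroup L] [InnerProductSpace ℂ L] [CompleteSpace L]
  (M : ContractiveMultiAnalytic d D L)

/-- The operator `Δ = (I - M* M)^{1/2}` on `Γ ⊗ D`. -/
abbrev ContractiveMultiAnalytic.Delta : Fock d D →L[ℂ] Fock d D := defectOp M.toCLM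

/-- The model space `(Γ ⊗ L) ⊕ (Δ (Γ ⊗ D))⁻`. -/
abbrev ContractiveMultiAnalytic.ModelSpace : Type _ :=
  WithLp 2 (Fock d L × RangeClosure M.Delta)

/-- The isometry `W ξ = M ξ ⊕ Δ ξ` from `Γ ⊗ D` to the model space. -/
def ContractiveMultiAnalytic.modelEmb : Fock d D →ₗᵢ[ℂ] M.ModelSpace where
  toLinearMap := (colOp M.toCLM (toRangeClosure M.Delta)).toLinearMap
  norm_map' ξ := by
    rw [← sq_eq_sq₀ (norm_nonneg _) (norm_nonneg _), WithLp.prod_norm_sq_eq_of_L2]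
    simp only [coe_coe, colOp_apply, WithLp.toLp_fst, WithLp.toLp_snd, norm_toRangeClosure]
    rw [norm_defectOp_sq _ M.norm_le]
    ring

theorem ContractiveMultiAnalytic.modelEmb_apply (ξ : Fock d D) :
    M.modelEmb ξ = WithLp.toLp 2 (M.toCLM ξ, toRangeClosure M.Delta ξ) := rfl

theorem ContractiveMultiAnalytic.inner_Delta_creation (i j : Fin d) (ξ η : Fock d D) :
    ⟪M.Delta (creation i ξ), M.Delta (creation j η)⟫_ℂ =
      if i = j then ⟪M.Delta ξ, M.Delta η⟫_ℂ else 0 := by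
  rw [inner_defectOp _ M.norm_le, inner_defectOp _ M.norm_le, M.intertwine, M.intertwine,
    inner_creation, inner_creation]
  split_ifs <;> simp

theorem ContractiveMultiAnalytic.norm_Delta_creation (j : Fin d) (ξ : Fock d D) :
    ‖(toRangeClosure M.Delta ∘L (creation j).toContinuousLinearMap) ξ‖ = ‖M.Delta ξ‖ := by
  have h := congrArg RCLike.re (M.inner_Delta_creation j j ξ ξ)
  rw [if_pos rfl, inner_self_eq_norm_sq, inner_self_eq_norm_sq] at h
  exact (sq_eq_sq₀ (norm_nonneg _) (norm_nonneg _)).1 h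

/-- The isometry `Δ ξ ↦ Δ (L_j ⊗ I) ξ` of `(Δ (Γ ⊗ D))⁻`. -/
def ContractiveMultiAnalytic.residualOp (j : Fin d) :
    RangeClosure M.Delta →ₗᵢ[ℂ] RangeClosure M.Delta :=
  rangeIsometry M.Delta (toRangeClosure M.Delta ∘L (creation j).toContinuousLinearMap)
    (M.norm_Delta_creation j)

theorem ContractiveMultiAnalytic.residualOp_apply (j : Fin d) (ξ : Fock d D) :
    M.residualOp j (toRangeClosure M.Delta ξ) = toRangeClosure M.Delta (creation j ξ) :=
  rangeIsometry_apply _ _ _ ξ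

theorem ContractiveMultiAnalytic.inner_residualOp (i j : Fin d) (x y : RangeClosure M.Delta) :
    ⟪M.residualOp i x, M.residualOp j y⟫_ℂ = if i = j then ⟪x, y⟫_ℂ else 0 := by
  split_ifs with hij
  · subst hij
    exact (M.residualOp i).inner_map_map x y
  · refine (denseRange_toRangeClosure M.Delta).induction_on₂
      (p := fun x y => ⟪M.residualOp i x, M.residualOp j y⟫_ℂ = 0) ?_ ?_ x y
    · exact isClosed_eq (((M.residualOp i).continuous.comp continuous_fst).inner
        ((M.residualOp j).continuous.comp continuous_snd)) continuous_const
    · intro ξ η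
      rw [M.residualOp_apply, M.residualOp_apply]
      exact (M.inner_Delta_creation i j ξ η).trans (if_neg hij)

/-- The row isometry `V_j (η ⊕ Δ ξ) = (L_j ⊗ I) η ⊕ Δ (L_j ⊗ I) ξ` on the model space. -/
def ContractiveMultiAnalytic.modelOp (j : Fin d) : M.ModelSpace →L[ℂ] M.ModelSpace :=
  colOp ((creation j).toContinuousLinearMap ∘L WithLp.fstL 2 ℂ (Fock d L) (RangeClosure M.Delta))
    ((M.residualOp j).toContinuousLinearMap ∘L
      WithLp.sndL 2 ℂ (Fock d L) (RangeClosure M.Delta))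

theorem ContractiveMultiAnalytic.modelOp_apply (j : Fin d) (x : M.ModelSpace) :
    M.modelOp j x = WithLp.toLp 2 (creation j x.fst, M.residualOp j x.snd) := rfl

theorem ContractiveMultiAnalytic.modelOp_modelEmb (j : Fin d) (ξ : Fock d D) :
    M.modelOp j (M.modelEmb ξ) = M.modelEmb (creation j ξ) := by
  rw [M.modelOp_apply, M.modelEmb_apply, M.modelEmb_apply, M.intertwine]
  simp only [WithLp.toLp_fst, WithLp.toLp_snd, M.residualOp_apply]

theorem ContractiveMultiAnalytic.isRowIsometry_modelOp : IsRowIsometry M.modelOp := by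
  intro i j x y
  rw [M.modelOp_apply, M.modelOp_apply, WithLp.prod_inner_apply, WithLp.prod_inner_apply]
  simp only [inner_creation, M.inner_residualOp, WithLp.ofLp_fst, WithLp.ofLp_snd]
  split_ifs <;> simp

end Model

/-! ### The lifting associated with a contractive multi-analytic operator -/

section ModelLifting

variable {d : ℕ} {HC D : Type*}
  [NormedAddCommGroup HC] [InnerProductSpace ℂ HC] [CompleteSpace HC]
  [NormedAddCommGroup D] [InnerProductSpace ℂ D] [CompleteSpace D]
  {C : RowContraction d HC} (M : ContractiveMultiAnalytic d D C.DefectSpace)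

/-- The space `HC ⊕ (Γ ⊗ D_C) ⊕ (Δ (Γ ⊗ D))⁻`. -/
abbrev BigSpace (M : ContractiveMultiAnalytic d D C.DefectSpace) : Type _ :=
  WithLp 2 (HC × M.ModelSpace)

/-- The row isometry on `HC ⊕ (Γ ⊗ D_C) ⊕ (Δ (Γ ⊗ D))⁻` that restricts to the minimal isometric
dilation of `C` on `HC ⊕ (Γ ⊗ D_C)` and to the model row isometry on the model space. -/
def bigOp (M : ContractiveMultiAnalytic d D C.DefectSpace) (j : Fin d) :
    BigSpace M →L[ℂ] BigSpace M :=
  colOp (C.op j ∘L WithLp.fstL 2 ℂ HC M.ModelSpace)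
    ((inlᵢ (Fock d C.DefectSpace) (RangeClosure M.Delta)).toContinuousLinearMap ∘L
        C.defectColumn j ∘L WithLp.fstL 2 ℂ HC M.ModelSpace +
      M.modelOp j ∘L WithLp.sndL 2 ℂ HC M.ModelSpace)

theorem bigOp_apply (j : Fin d) (x : BigSpace M) :
    bigOp M j x = WithLp.toLp 2 (C.op j x.fst,
      WithLp.toLp 2 (C.defectColumn j x.fst, 0) + M.modelOp j x.snd) := rfl

theorem bigOp_model (j : Fin d) (x : M.ModelSpace) :
    bigOp M j (inrᵢ HC M.ModelSpace x) = inrᵢ HC M.ModelSpace (M.modelOp j x) := by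
  rw [bigOp_apply]
  simp only [inrᵢ_apply, WithLp.toLp_fst, WithLp.toLp_snd, map_zero]
  congr 2
  exact zero_add _

theorem bigOp_dilation (j : Fin d) (h : HC) (η : Fock d C.DefectSpace) :
    bigOp M j (WithLp.toLp 2 (h, WithLp.toLp 2 (η, 0))) =
      WithLp.toLp 2 ((C.dilation j (WithLp.toLp 2 (h, η))).fst,
        WithLp.toLp 2 ((C.dilation j (WithLp.toLp 2 (h, η))).snd, 0)) := by
  rw [bigOp_apply, C.dilation_apply, M.modelOp_apply, ← WithLp.toLp_add]
  simp

theorem isRowIsometry_bigOp : IsRowIsometry (bigOp M) := by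
  intro i j x y
  have h1 := C.inner_defectColumn i j x.fst y.fst
  have h2 := C.inner_defectColumn_creation i j x.fst y.snd.fst
  have h3 := C.inner_defectColumn_creation j i y.fst x.snd.fst
  rw [← inner_conj_symm, map_eq_zero] at h3
  have h4 := M.isRowIsometry_modelOp i j x.snd y.snd
  have h5 : ∀ (a : Fock d C.DefectSpace) (k : Fin d) (z : M.ModelSpace),
      ⟪(WithLp.toLp 2 (a, 0) : M.ModelSpace), M.modelOp k z⟫_ℂ = ⟪a, creation k z.fst⟫_ℂ := by
    intro a k z
    rw [M.modelOp_apply, inner_toLp]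
    simp
  have h6 : ∀ (a : Fock d C.DefectSpace) (k : Fin d) (z : M.ModelSpace),
      ⟪M.modelOp k z, (WithLp.toLp 2 (a, 0) : M.ModelSpace)⟫_ℂ = ⟪creation k z.fst, a⟫_ℂ := by
    intro a k z
    rw [M.modelOp_apply, inner_toLp]
    simp
  have h7 : ∀ a b : Fock d C.DefectSpace, ⟪(WithLp.toLp 2 (a, 0) : M.ModelSpace),
      (WithLp.toLp 2 (b, 0) : M.ModelSpace)⟫_ℂ = ⟪a, b⟫_ℂ := by
    intro a b
    rw [inner_toLp]
    simp
  rw [bigOp_apply, bigOp_apply, inner_toLp, inner_withLp x y]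
  simp only [inner_add_left, inner_add_right, h5, h6, h7, h2, h3, h4, add_zero, zero_add]
  rw [← add_assoc, h1]
  split_ifs <;> simp

/-- The embedding `ξ ↦ 0 ⊕ W ξ` of `Γ ⊗ D` in `HC ⊕ (Γ ⊗ D_C) ⊕ (Δ (Γ ⊗ D))⁻`. -/
def bigEmb (M : ContractiveMultiAnalytic d D C.DefectSpace) : Fock d D →ₗᵢ[ℂ] BigSpace M :=
  (inrᵢ HC M.ModelSpace).comp M.modelEmb

theorem bigEmb_apply (ξ : Fock d D) : bigEmb M ξ = inrᵢ HC M.ModelSpace (M.modelEmb ξ) := rfl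

theorem bigOp_bigEmb (j : Fin d) (ξ : Fock d D) :
    bigOp M j (bigEmb M ξ) = bigEmb M (creation j ξ) := by
  rw [bigEmb_apply, bigOp_model, M.modelOp_modelEmb, bigEmb_apply]

/-- The space `HE = HC ⊕ H_A`, where `H_A` is the orthogonal complement of `W (Γ ⊗ D)` in the model
space; in other words, the orthogonal complement of `0 ⊕ W (Γ ⊗ D)` in the big space. -/
abbrev LiftSpace (M : ContractiveMultiAnalytic d D C.DefectSpace) : Submodule ℂ (BigSpace M) :=
  CompressionSpace (bigEmb M)

theorem inlᵢ_mem_liftSpace (x : HC) : inlᵢ HC M.ModelSpace x ∈ LiftSpace M := by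
  rw [mem_compressionSpace_iff]
  intro ξ
  rw [bigEmb_apply, inrᵢ_inner]
  exact inner_zero_right _

/-- The inclusion of `HC` in `HE`. -/
def liftEmb (M : ContractiveMultiAnalytic d D C.DefectSpace) : HC →ₗᵢ[ℂ] LiftSpace M :=
  restrictEmb (bigEmb M) (inlᵢ HC M.ModelSpace) (inlᵢ_mem_liftSpace M)

theorem isLifting_bigOp : IsLifting C.op (bigOp M) (inlᵢ HC M.ModelSpace) := by
  rw [isLifting_iff]
  intro j y
  rw [adjoint_inlᵢ_apply, adjoint_inlᵢ_apply]
  rfl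

/-- The row contraction on `HE`: the compression `E_j = P V_j |_{HE}` of the row isometry on the
big space. -/
def liftRow (M : ContractiveMultiAnalytic d D C.DefectSpace) : RowContraction d (LiftSpace M) :=
  compress (isRowIsometry_bigOp M) (bigEmb M)

/-- The contractive lifting `𝓔(M)` of `C`. -/
def modelLifting (M : ContractiveMultiAnalytic d D C.DefectSpace) :
    ContractiveLifting C (LiftSpace M) where
  row := liftRow M
  emb := liftEmb M
  isLifting := isLifting_compress (isRowIsometry_bigOp M) (bigEmb M) (inlᵢ HC M.ModelSpace)
    (inlᵢ_mem_liftSpace M) (isLifting_bigOp M)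

/-- The row isometry on the big space is an isometric dilation of the lifting `𝓔(M)`. -/
theorem isIsometricLifting_bigOp :
    IsIsometricLifting (modelLifting M).row (bigOp M) (LiftSpace M).subtypeₗᵢ :=
  isIsometricLifting_compress (isRowIsometry_bigOp M) (bigEmb M) creation (bigOp_bigEmb M)

end ModelLifting

end RowLifting

end

/-! The minimal isometric dilation of a row contraction `T` embeds into every isometric lifting `V`
of `T` by `x ⊕ η ↦ J x + fockEmb η` (`dilationEmb`), and this embedding intertwines the row
isometries. Its range is the closed linear span of the vectors `V_α J x` (`inner_wordOp_eq_zero_iff`).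

For a minimal lifting `E` let `δ` be in the kernel of the symbol. Then `e_∅ ⊗ δ` is orthogonal to the
base space and to the range of its Fock space embedding, hence to all `V^E_i V^E_α x` with `x` in the
base space. Since `V^E_α x` has the component `E_α x` in `HE` and `V^E_i` maps the other component
into the range of `L_i ⊗ I`, this says that `δ` is orthogonal to `D_E (0, …, E_α x, …, 0)`; by
minimality these vectors span a dense subspace of the defect space, so `δ = 0`
(`ContractiveLifting.symbol_injective`).

Conversely, for the lifting `𝓔(M)`, a vector of `HE` orthogonal to all `E_α x` is orthogonal to
`HC ⊕ (Γ ⊗ D_C)`, so it lies in the residual summand; being orthogonal to the range of `W` it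
vanishes there, which is minimality (`isMinimal_modelLifting`). The defect space of `𝓔(M)`, as a
subspace of the big space, is contained in `W (e_∅ ⊗ D)`. A vector `W (e_∅ ⊗ δ)` orthogonal to it is
orthogonal to the ranges of all the `V_i`, which forces `M (e_∅ ⊗ δ) = 0`; this is where injectivity
of the symbol gives equality and hence the unitary `v` (`exists_defectSpace_equiv`). Transporting the
definition of the characteristic function along `dilationEmb` then yields `M`
(`charFun_modelLifting`). -/

namespace RowLifting

open ContinuousLinearMap

/-! ### Embedding the minimal isometric dilation into an isometric lifting -/

section Embedding

variable {d : ℕ} {H K : Type*}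
  [NormedAddCommGroup H] [InnerProductSpace ℂ H] [CompleteSpace H]
  [NormedAddCommGroup K] [InnerProductSpace ℂ K] [CompleteSpace K]

theorem sum_summandEmb (ξ : PiLp 2 (fun _ : Fin d => H)) :
    ∑ i, summandEmb d H i (ξ i) = ξ := by
  ext k
  simp [summandEmb_apply]

theorem RowContraction.sum_defectColumn (T : RowContraction d H)
    (ξ : PiLp 2 (fun _ : Fin d => H)) :
    ∑ i, T.defectColumn i (ξ i) = basisVec [] (toRangeClosure T.defect ξ) := by
  conv_rhs => rw [← sum_summandEmb ξ, map_sum, map_sum]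
  rfl

theorem RowContraction.fst_wordOp_dilation (T : RowContraction d H) (α : List (Fin d))
    (x : T.DilationSpace) : (wordOp T.dilation α x).fst = wordOp T.op α x.fst := by
  induction α with
  | nil => simp
  | cons j α ih => rw [wordOp_cons, wordOp_cons, T.dilation_apply, WithLp.toLp_fst, ih]

/-- Orthogonality to the image of `Γ ⊗ D` can be checked on the vectors `e_α ⊗ δ`. -/
theorem inner_fock_eq_zero {D : Type*} [NormedAddCommGroup D] [InnerProductSpace ℂ D]
    [CompleteSpace D] (A : Fock d D →ₗᵢ[ℂ] K) {y : K}
    (h : ∀ α x, ⟪y, A (basisVec α x)⟫_ℂ = 0) (f : Fock d D) : ⟪y, A f⟫_ℂ = 0 := by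
  have e : innerSL ℂ y ∘L A.toContinuousLinearMap = 0 :=
    fock_ext fun α x => by simpa using h α x
  simpa using congrArg (fun B => B f) e

/-- Orthogonality to the image of a closure of a range can be checked on the range. -/
theorem inner_toRangeClosure_dense {X Y : Type*}
    [NormedAddCommGroup X] [InnerProductSpace ℂ X] [CompleteSpace X]
    [NormedAddCommGroup Y] [InnerProductSpace ℂ Y] [CompleteSpace Y]
    (A : X →L[ℂ] Y) (B : RangeClosure A →L[ℂ] K) {y : K}
    (h : ∀ ξ, ⟪y, B (toRangeClosure A ξ)⟫_ℂ = 0) (δ : RangeClosure A) : ⟪y, B δ⟫_ℂ = 0 := by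
  refine (denseRange_toRangeClosure A).induction_on (p := fun δ => ⟪y, B δ⟫_ℂ = 0) δ ?_ h
  exact isClosed_eq (continuous_const.inner B.continuous) continuous_const

variable {T : RowContraction d H} {V : Fin d → K →L[ℂ] K} {J : H →ₗᵢ[ℂ] K}

theorem IsIsometricLifting.defectEmb_toRangeClosure (h : IsIsometricLifting T V J)
    (ξ : PiLp 2 (fun _ : Fin d => H)) :
    h.defectEmb (toRangeClosure T.defect ξ) = ∑ i, (V i (J (ξ i)) - J (T.op i (ξ i))) := by
  rw [IsIsometricLifting.defectEmb, rangeIsometry_apply, rowDiff_apply]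

theorem IsIsometricLifting.map_emb (h : IsIsometricLifting T V J) (j : Fin d) (x : H) :
    V j (J x) = J (T.op j x) + h.fockEmb (T.defectColumn j x) := by
  have e : h.fockEmb (T.defectColumn j x) =
      h.defectEmb (toRangeClosure T.defect (summandEmb d H j x)) := h.fockEmb_basisVec [] _
  rw [e, h.defectEmb_toRangeClosure, Finset.sum_eq_single j]
  · simp [summandEmb_apply]
  · intro i _ hi
    simp [summandEmb_apply, hi]
  · simp

theorem IsIsometricLifting.inner_fockEmb (h : IsIsometricLifting T V J) (x : H)
    (f : Fock d T.DefectSpace) : ⟪J x, h.fockEmb f⟫_ℂ = 0 :=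
  inner_fock_eq_zero h.fockEmb
    (fun α δ => by rw [h.fockEmb_basisVec]; exact h.inner_word α x δ) f

/-- The isometry `x ⊕ η ↦ J x + fockEmb η` from the space of the minimal isometric dilation to the
space of an isometric lifting. -/
noncomputable def IsIsometricLifting.dilationEmb (h : IsIsometricLifting T V J) :
    T.DilationSpace →ₗᵢ[ℂ] K :=
  LinearMap.isometryOfInner
    (J.toLinearMap ∘ₗ (WithLp.fstL 2 ℂ H (Fock d T.DefectSpace)).toLinearMap +
      h.fockEmb.toLinearMap ∘ₗ (WithLp.sndL 2 ℂ H (Fock d T.DefectSpace)).toLinearMap) fun x y => by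
    have h1 := h.inner_fockEmb x.fst y.snd
    have h2 := h.inner_fockEmb y.fst x.snd
    rw [← inner_conj_symm, map_eq_zero] at h2
    change ⟪J x.fst + h.fockEmb x.snd, J y.fst + h.fockEmb y.snd⟫_ℂ = _
    rw [inner_add_left, inner_add_right, inner_add_right, h1, h2, J.inner_map_map,
      h.fockEmb.inner_map_map, inner_withLp, add_zero, zero_add]

theorem IsIsometricLifting.dilationEmb_apply (h : IsIsometricLifting T V J)
    (x : T.DilationSpace) : h.dilationEmb x = J x.fst + h.fockEmb x.snd := rfl

theorem IsIsometricLifting.dilationEmb_dilation (h : IsIsometricLifting T V J) (j : Fin d)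
    (x : T.DilationSpace) : h.dilationEmb (T.dilation j x) = V j (h.dilationEmb x) := by
  rw [T.dilation_apply, h.dilationEmb_apply, h.dilationEmb_apply, map_add, h.map_emb,
    ← h.fockEmb_creation, add_assoc, ← map_add]
  rfl

theorem IsIsometricLifting.dilationEmb_wordOp (h : IsIsometricLifting T V J) (α : List (Fin d))
    (x : T.DilationSpace) :
    h.dilationEmb (wordOp T.dilation α x) = wordOp V α (h.dilationEmb x) := by
  induction α with
  | nil => simp
  | cons j α ih => rw [wordOp_cons, wordOp_cons, h.dilationEmb_dilation, ih]

theorem IsIsometricLifting.wordOp_emb (h : IsIsometricLifting T V J) (α : List (Fin d)) (x : H) :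
    ∃ f, wordOp V α (J x) = J (wordOp T.op α x) + h.fockEmb f := by
  have e : h.dilationEmb (inlᵢ H (Fock d T.DefectSpace) x) = J x := by
    simp [h.dilationEmb_apply]
  rw [← e, ← h.dilationEmb_wordOp, h.dilationEmb_apply, T.fst_wordOp_dilation]
  exact ⟨_, rfl⟩

/-- A vector is orthogonal to the smallest `V`-invariant subspace containing `H` if and only if it
is orthogonal to `H` and to the canonical copy of `Γ ⊗ D_T`. -/
theorem IsIsometricLifting.inner_wordOp_eq_zero_iff (h : IsIsometricLifting T V J) (y : K) :
    (∀ α x, ⟪y, wordOp V α (J x)⟫_ℂ = 0) ↔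
      (∀ x, ⟪y, J x⟫_ℂ = 0) ∧ ∀ f, ⟪y, h.fockEmb f⟫_ℂ = 0 := by
  constructor
  · intro hy
    refine ⟨fun x => by simpa using hy [] x, inner_fock_eq_zero h.fockEmb fun α δ => ?_⟩
    rw [h.fockEmb_basisVec, ← h.wordEmb_apply]
    refine inner_toRangeClosure_dense T.defect (h.wordEmb α).toContinuousLinearMap (fun ξ => ?_) δ
    have hw : ∀ i x, ⟪y, wordOp V α (V i (J x))⟫_ℂ = 0 := by
      intro i x
      simpa [wordOp] using hy (α ++ [i]) x
    change ⟪y, wordOp V α (h.defectEmb (toRangeClosure T.defect ξ))⟫_ℂ = 0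
    rw [h.defectEmb_toRangeClosure, map_sum, inner_sum]
    refine Finset.sum_eq_zero fun i _ => ?_
    rw [map_sub, inner_sub_right, hw, hy, sub_zero]
  · rintro ⟨h1, h2⟩ α x
    obtain ⟨f, hf⟩ := h.wordOp_emb α x
    rw [hf, inner_add_right, h1, h2, add_zero]

/-- Vectors orthogonal to `H` and to the ranges of all the `V_i` are orthogonal to the canonical
copy of `Γ ⊗ D_T`. -/
theorem IsIsometricLifting.inner_fockEmb_eq_zero (h : IsIsometricLifting T V J) {y : K}
    (h1 : ∀ x, ⟪y, J x⟫_ℂ = 0) (h2 : ∀ i z, ⟪y, V i z⟫_ℂ = 0) (f : Fock d T.DefectSpace) :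
    ⟪y, h.fockEmb f⟫_ℂ = 0 := by
  refine (h.inner_wordOp_eq_zero_iff y).1 (fun α x => ?_) |>.2 f
  cases α with
  | nil => rw [wordOp_nil, h1]
  | cons j α => rw [wordOp_cons, h2]

end Embedding

/-! ### The symbol of a minimal lifting -/

section Symbol

variable {d : ℕ} {HC HE : Type*}
  [NormedAddCommGroup HC] [InnerProductSpace ℂ HC] [CompleteSpace HC]
  [NormedAddCommGroup HE] [InnerProductSpace ℂ HE] [CompleteSpace HE]
  {C : RowContraction d HC}

theorem ContractiveLifting.symbol_injective (E : ContractiveLifting C HE) (hE : E.IsMinimal) :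
    Function.Injective E.charFun.symbol := by
  rw [injective_iff_map_eq_zero]
  intro δ hδ
  have hM : E.charOp (basisVec [] δ) = 0 := hδ
  set y : E.row.DilationSpace := inrᵢ HE (Fock d E.row.DefectSpace) (basisVec [] δ) with hy
  have hperp : ∀ α x, ⟪y, wordOp E.row.dilation α
      ((inlᵢ HE (Fock d E.row.DefectSpace)).comp E.emb x)⟫_ℂ = 0 := by
    rw [E.isIsometricLifting.inner_wordOp_eq_zero_iff]
    refine ⟨fun x => ?_, fun f => ?_⟩
    · rw [hy, inrᵢ_inner]
      exact inner_zero_right _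
    · rw [← inner_conj_symm, hy, inner_inrᵢ, ← E.inner_charOp, hM, inner_zero_right, map_zero]
  -- the component of `V_i z` along `e_∅ ⊗ D_E` depends on the component of `z` in `HE` only
  have hcol : ∀ i (z : E.row.DilationSpace), ⟪y, E.row.dilation i z⟫_ℂ =
      ⟪δ, toRangeClosure E.row.defect (summandEmb d HE i z.fst)⟫_ℂ := by
    intro i z
    rw [hy, inrᵢ_inner, E.row.dilation_apply, WithLp.toLp_snd, inner_add_right,
      inner_basisVec_left, inner_basisVec_left, creation_nil, inner_zero_right, add_zero]
    congr 1
  have hdense : ∀ i w, ⟪δ, toRangeClosure E.row.defect (summandEmb d HE i w)⟫_ℂ = 0 := by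
    intro i w
    set A : HE →L[ℂ] ℂ := innerSL ℂ δ ∘L toRangeClosure E.row.defect ∘L
      (summandEmb d HE i).toContinuousLinearMap with hA
    have hle : (Submodule.span ℂ {y : HE | ∃ (α : List (Fin d)) (x : HC),
        y = wordOp E.row.op α (E.emb x)}).topologicalClosure ≤ LinearMap.ker A.toLinearMap := by
      refine Submodule.topologicalClosure_minimal _ (Submodule.span_le.2 ?_) A.isClosed_ker
      rintro _ ⟨α, x, rfl⟩
      have h1 := hperp (i :: α) x
      rw [wordOp_cons, hcol, E.row.fst_wordOp_dilation] at h1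
      exact h1
    rw [ContractiveLifting.IsMinimal] at hE
    rw [hE] at hle
    exact hle (Submodule.mem_top (x := w))
  have hzero : ∀ ε : E.row.DefectSpace, ⟪δ, ε⟫_ℂ = 0 :=
    inner_toRangeClosure_dense E.row.defect (ContinuousLinearMap.id ℂ _) fun ξ => by
      rw [← sum_summandEmb ξ, map_sum, map_sum, inner_sum]
      exact Finset.sum_eq_zero fun i _ => hdense i (ξ i)
  exact inner_self_eq_zero.1 (hzero δ)

end Symbol

/-! ### Complementing a lifting by a copy of a Fock space -/

section Complement

variable {d : ℕ} {H K D : Type*}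
  [NormedAddCommGroup H] [InnerProductSpace ℂ H] [CompleteSpace H]
  [NormedAddCommGroup K] [InnerProductSpace ℂ K] [CompleteSpace K]
  [NormedAddCommGroup D] [InnerProductSpace ℂ D] [CompleteSpace D]
  {T : RowContraction d H} {V : Fin d → K →L[ℂ] K} {J : H →ₗᵢ[ℂ] K}

/-- `K` is the orthogonal direct sum of the ranges of `J` and `W`, and `V_j W = W (L_j ⊗ I)`. -/
structure IsFockComplement (V : Fin d → K →L[ℂ] K) (J : H →ₗᵢ[ℂ] K) (W : Fock d D →ₗᵢ[ℂ] K) :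
    Prop where
  intertwine : ∀ j f, V j (W f) = W (creation j f)
  inner_eq_zero : ∀ f x, ⟪W f, J x⟫_ℂ = 0
  exists_add : ∀ k, ∃ x f, k = J x + W f

variable {W : Fock d D →ₗᵢ[ℂ] K}

/-- In the presence of a Fock space complement, the copy of the defect space is contained in the
image of `e_∅ ⊗ D`. -/
theorem IsFockComplement.defectEmb_mem (hW : IsFockComplement V J W)
    (h : IsIsometricLifting T V J) (ε : T.DefectSpace) :
    ∃ δ, h.defectEmb ε = W (basisVec [] δ) := by
  obtain ⟨w, ξ, hw⟩ := hW.exists_add (h.defectEmb ε)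
  have hw0 : w = 0 := by
    have h1 : ⟪J w, h.defectEmb ε⟫_ℂ = 0 := by simpa using h.inner_word [] w ε
    have h2 : ⟪J w, W ξ⟫_ℂ = 0 := by
      rw [← inner_conj_symm, hW.inner_eq_zero, map_zero]
    rw [hw, inner_add_right, h2, add_zero, J.inner_map_map] at h1
    exact inner_self_eq_zero.1 h1
  rw [hw0, map_zero, zero_add] at hw
  -- the defect space is orthogonal to `V_j W (Γ ⊗ D) = W (L_j ⊗ I) (Γ ⊗ D)`
  have hcre : ∀ j f, ⟪W (creation j f), h.defectEmb ε⟫_ℂ = 0 := by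
    intro j f
    refine inner_toRangeClosure_dense _ h.defectEmb.toContinuousLinearMap (fun η => ?_) ε
    change ⟪W (creation j f), h.defectEmb (toRangeClosure _ η)⟫_ℂ = 0
    rw [h.defectEmb_toRangeClosure, inner_sum]
    refine Finset.sum_eq_zero fun i _ => ?_
    rw [inner_sub_right, hW.inner_eq_zero, ← hW.intertwine, h.isometry, hW.inner_eq_zero]
    simp
  refine ⟨ξ [], ?_⟩
  rw [hw]
  congr 1
  ext α : 2
  rw [basisVec_apply]
  cases α with
  | nil => rw [if_pos rfl]
  | cons j α =>
    rw [if_neg (List.cons_ne_nil j α)]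
    refine ext_inner_left ℂ fun x => ?_
    have h4 := hcre j (basisVec α x)
    rw [hw, W.inner_map_map, creation_basisVec, inner_basisVec_left] at h4
    rw [h4, inner_zero_right]

/-- A vector of `W (e_∅ ⊗ D)` orthogonal to the copy of the defect space is orthogonal to the ranges
of the `V_i`. -/
theorem IsFockComplement.inner_map_eq_zero (hW : IsFockComplement V J W)
    (h : IsIsometricLifting T V J) {δ : D}
    (hδ : ∀ ε, ⟪W (basisVec [] δ), h.defectEmb ε⟫_ℂ = 0) (i : Fin d) (k : K) :
    ⟪W (basisVec [] δ), V i k⟫_ℂ = 0 := by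
  obtain ⟨x, ξ, rfl⟩ := hW.exists_add k
  have h1 : h.fockEmb (T.defectColumn i x) =
      h.defectEmb (toRangeClosure T.defect (summandEmb d H i x)) := h.fockEmb_basisVec [] _
  rw [map_add, h.map_emb, inner_add_right, inner_add_right, hW.inner_eq_zero, h1, hδ,
    hW.intertwine, W.inner_map_map, inner_basisVec_left, creation_nil, inner_zero_right, add_zero,
    add_zero]

/-- If no nonzero vector of `W (e_∅ ⊗ D)` is orthogonal to the ranges of all the `V_i`, then
`W (e_∅ ⊗ D)` is the canonical copy of the defect space. -/
theorem IsFockComplement.exists_equiv (hW : IsFockComplement V J W)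
    (h : IsIsometricLifting T V J)
    (hinj : ∀ δ, (∀ i k, ⟪W (basisVec [] δ), V i k⟫_ℂ = 0) → δ = 0) :
    ∃ v : D ≃ₗᵢ[ℂ] T.DefectSpace, ∀ δ, h.defectEmb (v δ) = W (basisVec [] δ) := by
  set G : D →ₗᵢ[ℂ] K := W.comp (basisVec []) with hG
  have hsurj : ∀ δ, ∃ ε, h.defectEmb ε = G δ := by
    intro δ
    set ε := adjoint h.defectEmb.toContinuousLinearMap (G δ) with hε
    obtain ⟨δ', hδ'⟩ := hW.defectEmb_mem h ε
    change _ = G δ' at hδ'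
    -- `G δ - h.defectEmb ε` is the component of `G δ` orthogonal to the copy of the defect space
    have h0 : δ - δ' = 0 := by
      refine hinj _ (hW.inner_map_eq_zero h fun ε' => ?_)
      change ⟪G (δ - δ'), _⟫_ℂ = 0
      have h1 : G δ - h.defectEmb ε ∈ (LinearMap.range h.defectEmb.toLinearMap)ᗮ := by
        rw [mem_orthogonal_range_iff, map_sub, adjoint_isometry_apply, hε, sub_self]
      rw [map_sub, ← hδ']
      exact (Submodule.mem_orthogonal' _ _).1 h1 _ (LinearMap.mem_range_self _ ε')
    exact ⟨ε, by rw [sub_eq_zero.1 h0, hδ']⟩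
  have hrange : LinearMap.range G.toLinearMap = LinearMap.range h.defectEmb.toLinearMap := by
    refine le_antisymm ?_ ?_
    · rintro _ ⟨δ, rfl⟩
      exact hsurj δ
    · rintro _ ⟨ε, rfl⟩
      obtain ⟨δ, hδ⟩ := hW.defectEmb_mem h ε
      exact ⟨δ, hδ.symm⟩
  refine ⟨(G.equivRange.trans (LinearIsometryEquiv.ofEq _ _ hrange)).trans
    h.defectEmb.equivRange.symm, fun δ => ?_⟩
  exact congrArg Subtype.val (h.defectEmb.equivRange.apply_symm_apply
    (LinearIsometryEquiv.ofEq _ _ hrange (G.equivRange δ)))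

theorem IsFockComplement.fockEmb_amplify (hW : IsFockComplement V J W)
    (h : IsIsometricLifting T V J) (v : D →ₗᵢ[ℂ] T.DefectSpace)
    (hv : ∀ δ, h.defectEmb (v δ) = W (basisVec [] δ)) (ξ : Fock d D) :
    h.fockEmb (amplify d v ξ) = W ξ := by
  have e : h.fockEmb.toContinuousLinearMap ∘L (amplify d v).toContinuousLinearMap =
      W.toContinuousLinearMap := by
    refine fock_ext fun α δ => ?_
    change h.fockEmb (amplify d v (basisVec α δ)) = W (basisVec α δ)
    rw [amplify_basisVec, h.fockEmb_basisVec, hv]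
    induction α with
    | nil => rw [wordOp_nil]
    | cons j α ih => rw [wordOp_cons, ih, hW.intertwine, creation_basisVec]
  exact congrArg (fun A => A ξ) e

end Complement

/-! ### Contractive liftings inside an isometric lifting -/

section IteratedLifting

variable {d : ℕ} {HC HE K D : Type*}
  [NormedAddCommGroup HC] [InnerProductSpace ℂ HC] [CompleteSpace HC]
  [NormedAddCommGroup HE] [InnerProductSpace ℂ HE] [CompleteSpace HE]
  [NormedAddCommGroup K] [InnerProductSpace ℂ K] [CompleteSpace K]
  [NormedAddCommGroup D] [InnerProductSpace ℂ D] [CompleteSpace D]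
  {C : RowContraction d HC} {E : ContractiveLifting C HE} {V : Fin d → K →L[ℂ] K}
  {J : HE →ₗᵢ[ℂ] K} {J₀ : HC →ₗᵢ[ℂ] K}

/-- The canonical copies of `Γ ⊗ D_C` in the minimal isometric dilation of `E` and in another
isometric lifting of `E` correspond to each other. -/
theorem ContractiveLifting.dilationEmb_fockEmb (h : IsIsometricLifting E.row V J)
    (h₀ : IsIsometricLifting C V J₀) (hJ : ∀ x, J (E.emb x) = J₀ x) (f : Fock d C.DefectSpace) :
    h.dilationEmb (E.isIsometricLifting.fockEmb f) = h₀.fockEmb f := by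
  have hemb : ∀ x, h.dilationEmb ((inlᵢ HE (Fock d E.row.DefectSpace)).comp E.emb x) = J₀ x := by
    intro x
    rw [h.dilationEmb_apply, ← hJ]
    exact (congrArg₂ (· + ·) rfl (map_zero h.fockEmb)).trans (add_zero _)
  have hdef : ∀ δ, h.dilationEmb (E.isIsometricLifting.defectEmb δ) = h₀.defectEmb δ := by
    intro δ
    refine (denseRange_toRangeClosure C.defect).induction_on
      (p := fun δ => h.dilationEmb (E.isIsometricLifting.defectEmb δ) = h₀.defectEmb δ) δ ?_
      fun ξ => ?_
    · exact isClosed_eq (h.dilationEmb.continuous.comp E.isIsometricLifting.defectEmb.continuous)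
        h₀.defectEmb.continuous
    · rw [IsIsometricLifting.defectEmb_toRangeClosure, h₀.defectEmb_toRangeClosure, map_sum]
      refine Finset.sum_congr rfl fun i _ => ?_
      rw [map_sub, h.dilationEmb_dilation, hemb, hemb]
  have e : h.dilationEmb.toContinuousLinearMap ∘L
      E.isIsometricLifting.fockEmb.toContinuousLinearMap = h₀.fockEmb.toContinuousLinearMap := by
    refine fock_ext fun α δ => ?_
    change h.dilationEmb (E.isIsometricLifting.fockEmb (basisVec α δ)) =
      h₀.fockEmb (basisVec α δ)
    rw [IsIsometricLifting.fockEmb_basisVec, h₀.fockEmb_basisVec, h.dilationEmb_wordOp, hdef]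
  exact congrArg (fun A => A f) e

/-- The characteristic function computed inside an arbitrary isometric lifting of `E`. -/
theorem ContractiveLifting.inner_charFun_eq (h : IsIsometricLifting E.row V J)
    (h₀ : IsIsometricLifting C V J₀) (hJ : ∀ x, J (E.emb x) = J₀ x) (f : Fock d C.DefectSpace)
    (g : Fock d E.row.DefectSpace) :
    ⟪f, E.charFun.toCLM g⟫_ℂ = ⟪h₀.fockEmb f, h.fockEmb g⟫_ℂ := by
  change ⟪f, E.charOp g⟫_ℂ = _
  have hr : h.dilationEmb (inrᵢ HE (Fock d E.row.DefectSpace) g) = h.fockEmb g := by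
    rw [h.dilationEmb_apply]
    exact (congrArg₂ (· + ·) (map_zero J) rfl).trans (zero_add _)
  rw [E.inner_charOp, ← inner_inrᵢ, ← h.dilationEmb.inner_map_map, hr,
    ContractiveLifting.dilationEmb_fockEmb h h₀ hJ]

/-- A lifting `E` is minimal if no nonzero vector of `HE` is orthogonal to `HC` and to the canonical
copy of `Γ ⊗ D_C`. -/
theorem ContractiveLifting.isMinimal_of_inner (h : IsIsometricLifting E.row V J)
    (h₀ : IsIsometricLifting C V J₀) (hJ : ∀ x, J (E.emb x) = J₀ x)
    (hy : ∀ y, (∀ x, ⟪J y, J₀ x⟫_ℂ = 0) → (∀ f, ⟪J y, h₀.fockEmb f⟫_ℂ = 0) → y = 0) :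
    E.IsMinimal := by
  rw [ContractiveLifting.IsMinimal, Submodule.topologicalClosure_eq_top_iff, Submodule.eq_bot_iff]
  intro y hyE
  rw [Submodule.mem_orthogonal'] at hyE
  have hV : ∀ α x, ⟪J y, wordOp V α (J₀ x)⟫_ℂ = 0 := by
    intro α x
    obtain ⟨f, hf⟩ := h.wordOp_emb α (E.emb x)
    rw [← hJ, hf, inner_add_right, h.inner_fockEmb, J.inner_map_map, add_zero]
    exact hyE _ (Submodule.subset_span ⟨α, x, rfl⟩)
  obtain ⟨h1, h2⟩ := (h₀.inner_wordOp_eq_zero_iff _).1 hV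
  exact hy y h1 h2

end IteratedLifting

/-! ### The lifting associated with a contractive multi-analytic operator -/

section ModelLifting

variable {d : ℕ} {HC D : Type*}
  [NormedAddCommGroup HC] [InnerProductSpace ℂ HC] [CompleteSpace HC]
  [NormedAddCommGroup D] [InnerProductSpace ℂ D] [CompleteSpace D]
  {C : RowContraction d HC} (M : ContractiveMultiAnalytic d D C.DefectSpace)

/-- The row isometry on the big space is an isometric dilation of `C`. -/
theorem isIsometricLifting_bigOp_base :
    IsIsometricLifting C (bigOp M) (inlᵢ HC M.ModelSpace) where
  isometry := isRowIsometry_bigOp M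
  lifting := isLifting_bigOp M

theorem fockEmb_bigOp (f : Fock d C.DefectSpace) :
    (isIsometricLifting_bigOp_base M).fockEmb f =
      inrᵢ HC M.ModelSpace (inlᵢ (Fock d C.DefectSpace) (RangeClosure M.Delta) f) := by
  set h := isIsometricLifting_bigOp_base M
  set B := (inrᵢ HC M.ModelSpace).comp
    (inlᵢ (Fock d C.DefectSpace) (RangeClosure M.Delta)) with hB
  have hcre : ∀ j f, bigOp M j (B f) = B (creation j f) := by
    intro j f
    change bigOp M j (inrᵢ HC M.ModelSpace _) = inrᵢ HC M.ModelSpace _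
    rw [bigOp_model, M.modelOp_apply]
    simp
  have hcol : ∀ j x, bigOp M j (inlᵢ HC M.ModelSpace x) - inlᵢ HC M.ModelSpace (C.op j x) =
      B (C.defectColumn j x) := by
    intro j x
    rw [sub_eq_iff_eq_add', h.map_emb]
    rw [← sub_eq_iff_eq_add', ← h.map_emb, bigOp_apply]
    simp only [inlᵢ_apply, ← WithLp.toLp_sub, WithLp.toLp_fst, WithLp.toLp_snd, map_zero,
      add_zero, Prod.mk_sub_mk, sub_self, sub_zero]
    rfl
  have hdef : ∀ δ, h.defectEmb δ = B (basisVec [] δ) := by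
    intro δ
    refine (denseRange_toRangeClosure C.defect).induction_on
      (p := fun δ => h.defectEmb δ = B (basisVec [] δ)) δ ?_ fun ξ => ?_
    · exact isClosed_eq h.defectEmb.continuous (B.continuous.comp (basisVec []).continuous)
    · rw [h.defectEmb_toRangeClosure, ← C.sum_defectColumn, map_sum]
      exact Finset.sum_congr rfl fun i _ => hcol i (ξ i)
  have e : h.fockEmb.toContinuousLinearMap = B.toContinuousLinearMap := by
    refine fock_ext fun α δ => ?_
    change h.fockEmb (basisVec α δ) = B (basisVec α δ)
    rw [h.fockEmb_basisVec]
    induction α with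
    | nil => rw [wordOp_nil, hdef]
    | cons j α ih => rw [wordOp_cons, ih, hcre, creation_basisVec]
  exact congrArg (fun A => A f) e

theorem inner_fockEmb_bigEmb (f : Fock d C.DefectSpace) (ξ : Fock d D) :
    ⟪(isIsometricLifting_bigOp_base M).fockEmb f, bigEmb M ξ⟫_ℂ = ⟪f, M.toCLM ξ⟫_ℂ := by
  rw [fockEmb_bigOp, bigEmb_apply, LinearIsometry.inner_map_map, inlᵢ_inner, M.modelEmb_apply,
    WithLp.toLp_fst]

theorem inner_bigEmb_inl (ξ : Fock d D) (x : HC) :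
    ⟪bigEmb M ξ, inlᵢ HC M.ModelSpace x⟫_ℂ = 0 := by
  rw [bigEmb_apply, inrᵢ_inner]
  exact inner_zero_right _

theorem eq_zero_of_mem_liftSpace {y : BigSpace M} (hy : y ∈ LiftSpace M)
    (h1 : ∀ x, ⟪y, inlᵢ HC M.ModelSpace x⟫_ℂ = 0)
    (h2 : ∀ f, ⟪y, (isIsometricLifting_bigOp_base M).fockEmb f⟫_ℂ = 0) : y = 0 := by
  have hfst : y.fst = 0 := by
    have h3 := h1 y.fst
    rw [← inner_conj_symm, inlᵢ_inner, map_eq_zero] at h3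
    exact inner_self_eq_zero.1 h3
  have hsf : y.snd.fst = 0 := by
    have h3 := h2 y.snd.fst
    rw [fockEmb_bigOp, ← inner_conj_symm, inrᵢ_inner, inlᵢ_inner, map_eq_zero] at h3
    exact inner_self_eq_zero.1 h3
  -- the residual component is orthogonal to the range of `Δ`, as `y` is orthogonal to `W ξ`
  have hss : y.snd.snd = 0 := by
    refine inner_self_eq_zero.1 (inner_toRangeClosure_dense M.Delta
      (ContinuousLinearMap.id ℂ _) (fun ξ => ?_) _)
    have h3 := (mem_compressionSpace_iff (bigEmb M) _).1 hy ξ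
    rw [bigEmb_apply, inrᵢ_inner, M.modelEmb_apply, inner_withLp, hsf, inner_zero_right,
      zero_add] at h3
    rw [← inner_conj_symm, map_eq_zero]
    exact h3
  refine WithLp.ofLp_injective 2 (Prod.ext hfst ?_)
  exact WithLp.ofLp_injective 2 (Prod.ext hsf hss)

theorem isMinimal_modelLifting : (modelLifting M).IsMinimal :=
  ContractiveLifting.isMinimal_of_inner (isIsometricLifting_bigOp M)
    (isIsometricLifting_bigOp_base M) (fun _ => rfl)
    fun y h1 h2 => Subtype.ext (eq_zero_of_mem_liftSpace M y.2 h1 h2)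

theorem isFockComplement_bigEmb :
    IsFockComplement (bigOp M) (LiftSpace M).subtypeₗᵢ (bigEmb M) where
  intertwine := bigOp_bigEmb M
  inner_eq_zero f x := (mem_compressionSpace_iff (bigEmb M) _).1 x.2 f
  exists_add k := by
    refine ⟨⟨k - bigEmb M (adjoint (bigEmb M).toContinuousLinearMap k), ?_⟩, _,
      (sub_add_cancel _ _).symm⟩
    refine (mem_orthogonal_range_iff (bigEmb M) _).2 ?_
    rw [map_sub, adjoint_isometry_apply, sub_self]

/-- A vector `W (e_∅ ⊗ δ)` orthogonal to the ranges of the `V_i` is in the kernel of the symbol. -/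
theorem symbol_eq_zero_of_inner {δ : D}
    (hδ : ∀ i k, ⟪bigEmb M (basisVec [] δ), bigOp M i k⟫_ℂ = 0) : M.symbol δ = 0 := by
  refine ext_inner_left ℂ fun f => ?_
  have h1 := (isIsometricLifting_bigOp_base M).inner_fockEmb_eq_zero
    (inner_bigEmb_inl M (basisVec [] δ)) hδ f
  rw [← inner_conj_symm, inner_fockEmb_bigEmb, map_eq_zero] at h1
  rw [inner_zero_right]
  exact h1

/-- If the symbol of `M` is injective, then `W (e_∅ ⊗ D)` is the canonical copy of the defect space
of `𝓔(M)`. -/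
theorem exists_defectSpace_equiv (hM : Function.Injective M.symbol) :
    ∃ v : D ≃ₗᵢ[ℂ] (modelLifting M).row.DefectSpace,
      ∀ δ, (isIsometricLifting_bigOp M).defectEmb (v δ) = bigEmb M (basisVec [] δ) :=
  (isFockComplement_bigEmb M).exists_equiv (isIsometricLifting_bigOp M) fun _ hδ =>
    hM ((symbol_eq_zero_of_inner M hδ).trans (map_zero _).symm)

/-- The characteristic function of `𝓔(M)` is `M`, up to an identification of `D` with the defect
space. -/
theorem charFun_modelLifting (v : D →ₗᵢ[ℂ] (modelLifting M).row.DefectSpace)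
    (hv : ∀ δ, (isIsometricLifting_bigOp M).defectEmb (v δ) = bigEmb M (basisVec [] δ))
    (ξ : Fock d D) : (modelLifting M).charFun.toCLM (amplify d v ξ) = M.toCLM ξ := by
  refine ext_inner_left ℂ fun f => ?_
  refine (ContractiveLifting.inner_charFun_eq (isIsometricLifting_bigOp M)
    (isIsometricLifting_bigOp_base M) (fun _ => rfl) f _).trans ?_
  rw [(isFockComplement_bigEmb M).fockEmb_amplify _ v hv, inner_fockEmb_bigEmb]

end ModelLifting

end RowLifting

theorem corollary3p3 {d : ℕ} {HC : Type*} [NormedAddCommGroup HC] [InnerProductSpace ℂ HC]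
    [CompleteSpace HC] (C : RowLifting.RowContraction d HC) :
    (∀ (HE : Type*) [NormedAddCommGroup HE] [InnerProductSpace ℂ HE] [CompleteSpace HE]
      (E : RowLifting.ContractiveLifting C HE), E.IsMinimal →
        Function.Injective E.charFun.symbol) ∧
    (∀ (D : Type*) [NormedAddCommGroup D] [InnerProductSpace ℂ D] [CompleteSpace D]
      (M : RowLifting.ContractiveMultiAnalytic d D C.DefectSpace),
      Function.Injective M.symbol →
        (RowLifting.modelLifting M).IsMinimal ∧
        ∃ v : D ≃ₗᵢ[ℂ] (RowLifting.modelLifting M).row.DefectSpace,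
          -- `v` is the canonical identification, inside the dilation space of `𝓔(M)`
          (∀ δ : D, (RowLifting.isIsometricLifting_bigOp M).defectEmb (v δ) =
            RowLifting.bigEmb M (RowLifting.basisVec [] δ)) ∧
          -- and it identifies the characteristic function of `𝓔(M)` with `M`
          ∀ ξ : RowLifting.Fock d D,
            (RowLifting.modelLifting M).charFun.toCLM
              (RowLifting.amplify d v.toLinearIsometry ξ) = M.toCLM ξ) := by
  exact ⟨fun HE _ _ _ E hE => E.symbol_injective hE, fun D _ _ _ M hM =>
    ⟨RowLifting.isMinimal_modelLifting M, (RowLifting.exists_defectSpace_equiv M hM).imp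
      fun v hv => ⟨hv, RowLifting.charFun_modelLifting M v.toLinearIsometry hv⟩⟩⟩
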